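/- Let $d\ge 1$, let $B_d$ be the open unit ball of $\mathbb{C}^d$, let $S_d=\partial B_d$, and let $\mathbb{D}=B_1$. Let $M(S_d)$ be the space of complex Borel measures on $S_d$, with total variation norm $\|\cdot\|$, and let $\sigma_d$ be the normalized Lebesgue measure on $S_d$. Let $\mathbb{P}^{d-1}$ be the space of one-dimensional linear subspaces of $\mathbb{C}^d$, let $\pi:S_d\to\mathbb{P}^{d-1}$ be the canonical projection, and let $\widehat\sigma_d$ be the unitarily invariant probability measure on $\mathbb{P}^{d-1}$, so that $\widehat\sigma_d(E)=\sigma_d(\pi^{-1}(E))$ for Borel sets $E$. A measure $\mu\in M(S_d)$ is called *pluriharmonic* if its invariant Poisson integral \[ P[\mu](z)=\int_{S_d}\left(\frac{1-|z|^2}{|1-\langle z,\zeta\rangle|^2}\right)^{d}d\mu(\zeta),\qquad z\in B_d, \] is a pluriharmonic function, that is, of class $C^2$ in $B_d$ and harmonic on the part in $B_d$ of every complex line. It is called *decomposable* if there are measures $\nu_\zeta\in M(S_d)$, defined for $\widehat\sigma_d$-a.e. $\zeta\in\mathbb{P}^{d-1}$, such that $\operatorname{supp}\nu_\zeta\subset\pi^{-1}(\zeta)$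 for $\widehat\sigma_d$-a.e. $\zeta$, the function $\zeta\mapsto\|\nu_\zeta\|$ is integrable with respect to $\widehat\sigma_d$, and $\mu=\int_{\mathbb{P}^{d-1}}\nu_\zeta\,d\widehat\sigma_d(\zeta)$ in the weak sense, that is, for every $f\in C(S_d)$ the function $\zeta\mapsto\int_{S_d}f\,d\nu_\zeta$ is integrable with respect to $\widehat\sigma_d$ and \[ \int_{S_d}f\,d\mu=\int_{\mathbb{P}^{d-1}}\int_{S_d}f\,d\nu_\zeta\,d\widehat\sigma_d(\zeta). \] Let $\mu\in M(S_d)$ be pluriharmonic. Then for $\widehat\sigma_d$-a.e. $\zeta\in\mathbb{P}^{d-1}$ there is a unique measure $\mu_\zeta\in M(S_d)$ (the *slice measure* of $\mu$ at $\zeta$) such that $\operatorname{supp}\mu_\zeta\subset\pi^{-1}(\zeta)$ and \[ P[\mu](z\xi)=\int_{S_d}\frac{1-|z|^2}{|w-z\xi|^2}\,d\mu_\zeta(w)\qquad\text{for all }z\in\mathbb{D}\text{ and all }\xi\in\pi^{-1}(\zeta) . \] Moreover, the function $\zeta\mapsto\|\mu_\zeta\|$ is integrable with respect to $\widehat\sigma_d$,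 and \[ \mu=\int_{\mathbb{P}^{d-1}}\mu_\zeta\,d\widehat\sigma_d(\zeta) \] in the weak sense. In particular, every pluriharmonic measure on $S_d$ is decomposable. -/

import Mathlib

open MeasureTheory Metric

noncomputable section

namespace SliceDecomposition

/-- Complex Euclidean space of dimension `d`. -/
abbrev Cn (d : ℕ) : Type := EuclideanSpace ℂ (Fin d)

/-- The unit sphere of `ℂ^d`, with its Borel σ-algebra. -/
abbrev Sph (d : ℕ) : Type := sphere (0 : Cn d) 1

/-- Complex projective space of dimension `d - 1`: the set of one-dimensional linear subspaces
of `ℂ^d`. -/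
abbrev Proj (d : ℕ) : Type := Projectivization ℂ (Cn d)

/-- The quotient topology from the nonzero vectors. -/
instance instTopologicalSpaceProj (d : ℕ) : TopologicalSpace (Proj d) :=
  inferInstanceAs (TopologicalSpace (Quotient (projectivizationSetoid ℂ (Cn d))))

instance instMeasurableSpaceProj (d : ℕ) : MeasurableSpace (Proj d) := borel (Proj d)

instance instBorelSpaceProj (d : ℕ) : BorelSpace (Proj d) := ⟨rfl⟩

/-- The canonical projection of the unit sphere onto projective space. -/
def proj {d : ℕ} (ξ : Sph d) : Proj d :=
  Projectivization.mk ℂ (ξ : Cn d) (ne_zero_of_mem_unit_sphere ξ)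

theorem continuous_proj {d : ℕ} : Continuous (proj (d := d)) := by
  have h : Continuous (fun ξ : Sph d =>
      (⟨(ξ : Cn d), ne_zero_of_mem_unit_sphere ξ⟩ : {v : Cn d // v ≠ 0})) :=
    Continuous.subtype_mk continuous_subtype_val _
  exact (continuous_quotient_mk' (s := projectivizationSetoid ℂ (Cn d))).comp h

/-- The normalized Lebesgue measure on the unit sphere of `ℂ^d`. -/
def sphereMeasure (d : ℕ) : Measure (Sph d) :=
  ((volume : Measure (Cn d)).toSphere Set.univ)⁻¹ • (volume : Measure (Cn d)).toSphere

/-- The unitarily invariant probability measure on projective space, which is the image of the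
normalized Lebesgue measure of the sphere (the projection is continuous, hence measurable). -/
def projMeasure (d : ℕ) : Measure (Proj d) := (sphereMeasure d).map proj

/-- The integral `∫ f dμ` of a complex function against a complex measure. -/
def cIntegral {X : Type*} [MeasurableSpace X] (μ : ComplexMeasure X) (f : X → ℂ) : ℂ :=
  μ.integral f (ContinuousLinearMap.mul ℝ ℂ)

/-- The total variation norm `‖μ‖ = |μ|(X)` of a complex measure. -/
def cNorm {X : Type*} [MeasurableSpace X] (μ : ComplexMeasure X) : ENNReal :=
  μ.variation Set.univ

/-- The invariant Poisson kernel `((1 - |z|²) / |1 - ⟨z, ζ⟩|²)^d`, where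
`⟨z, ζ⟩ = ∑ z_j * conj ζ_j`, so that `⟨z, ζ⟩ = inner ℂ ζ z`. -/
def poissonKernel {d : ℕ} (z ζ : Cn d) : ℝ :=
  ((1 - ‖z‖ ^ 2) / ‖1 - inner ℂ ζ z‖ ^ 2) ^ d

/-- The invariant Poisson integral `P[μ]`, considered for `z` in the open unit ball. -/
def poissonIntegral {d : ℕ} (μ : ComplexMeasure (Sph d)) (z : Cn d) : ℂ :=
  cIntegral μ fun ζ => (poissonKernel z (ζ : Cn d) : ℂ)

/-- A complex function is pluriharmonic in the open unit ball if it is of class `C²` there and its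
restriction to the part in the ball of each complex line `l ↦ a + l b` is harmonic. -/
def IsPluriharmonicOnBall {d : ℕ} (u : Cn d → ℂ) : Prop :=
  ContDiffOn ℝ 2 u (ball 0 1) ∧
    ∀ a b : Cn d, InnerProductSpace.HarmonicOnNhd (fun l : ℂ => u (a + l • b))
      {l : ℂ | a + l • b ∈ ball (0 : Cn d) 1}

/-- A complex measure on the sphere is pluriharmonic if its invariant Poisson integral is
pluriharmonic. -/
def IsPluriharmonicMeasure {d : ℕ} (μ : ComplexMeasure (Sph d)) : Prop :=
  IsPluriharmonicOnBall (poissonIntegral μ)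

/-- The closed support of `ν`, i.e. that of its total variation, lies in the circle over `ζ`. -/
def IsSupportedOnCircle {d : ℕ} (ζ : Proj d) (ν : ComplexMeasure (Sph d)) : Prop :=
  ν.variation.support ⊆ proj ⁻¹' {ζ}

/-- `ν` is a slice measure of `μ` at `ζ`: it is supported on the circle over `ζ`, and for all points
`ξ` of this circle the slice function `z ↦ P[μ](z ξ)` on the unit disk is the
Poisson integral of `ν`. -/
def IsSliceMeasure {d : ℕ} (μ : ComplexMeasure (Sph d)) (ζ : Proj d)
    (ν : ComplexMeasure (Sph d)) : Prop :=
  IsSupportedOnCircle ζ ν ∧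
    ∀ ξ : Sph d, proj ξ = ζ → ∀ z : ℂ, ‖z‖ < 1 →
      poissonIntegral μ (z • (ξ : Cn d)) =
        cIntegral ν fun w =>
          (((1 - ‖z‖ ^ 2) / ‖(w : Cn d) - z • (ξ : Cn d)‖ ^ 2 : ℝ) : ℂ)

open Classical in
/-- The slice measure of `μ` at `ζ`; it is set to be `0` at those `ζ` where there is none. -/
def sliceMeasure {d : ℕ} (μ : ComplexMeasure (Sph d)) (ζ : Proj d) : ComplexMeasure (Sph d) :=
  if h : ∃ ν, IsSliceMeasure μ ζ ν then h.choose else 0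

/-- `μ = ∫ ν_ζ dσ̂(ζ)` in the weak sense: for almost all `ζ` the measure `ν_ζ` is supported on the
circle over `ζ`, the function `ζ ↦ ‖ν_ζ‖` is integrable, and
`∫ f dμ = ∫ (∫ f dν_ζ) dσ̂(ζ)` for all continuous functions `f` on the sphere, where the
outer integral exists as a Lebesgue integral. -/
structure IsDecomposition {d : ℕ} (μ : ComplexMeasure (Sph d))
    (ν : Proj d → ComplexMeasure (Sph d)) : Prop where
  supported : ∀ᵐ ζ ∂projMeasure d, IsSupportedOnCircle ζ (ν ζ)
  aemeasurable_norm : AEMeasurable (fun ζ => cNorm (ν ζ)) (projMeasure d)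
  lintegral_norm_lt_top : ∫⁻ ζ, cNorm (ν ζ) ∂projMeasure d < ⊤
  integrable : ∀ f : C(Sph d, ℂ), Integrable (fun ζ => cIntegral (ν ζ) f) (projMeasure d)
  integral_eq : ∀ f : C(Sph d, ℂ), cIntegral μ f = ∫ ζ, cIntegral (ν ζ) f ∂projMeasure d

/-- A complex measure on the sphere is decomposable if it is the weak integral of a family of
measures on the circles over the points of projective space. -/
def IsDecomposable {d : ℕ} (μ : ComplexMeasure (Sph d)) : Prop :=
  ∃ ν : Proj d → ComplexMeasure (Sph d), IsDecomposition μ ν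

end SliceDecomposition

end

open SliceDecomposition

/-! Write u = P[μ] and u_r(ξ) = u(rξ) for the dilates on the sphere. The invariant Poisson kernel is
nonnegative and has integral one in the variable ξ (`integral_poissonKernel`), so Fubini gives
∫|u_r| dσ ≤ ‖μ‖. The measure σ is the average over projective space of the uniform measures on the
circles (`integral_projMeasure_fiberMeasure`). Fatou's lemma therefore makes the lower limit, as r →
1, of the L¹ norms of u_r on the circle over ζ an integrable function of ζ
(`lintegral_liminf_fiberNorm_lt_top`), finite almost everywhere.

Where it is finite, the classical argument for harmonic functions with bounded L¹ means applies:
along suitable radii the densities u_r on the circle have a weak limit ν, and passing to the limit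
in the Poisson formula on the disk shows that the slice of u is the Poisson integral of ν
(`exists_isSliceMeasure`). Pluriharmonicity enters only through harmonicity on disks through the
origin and continuity of u.

Conversely, the disk Poisson kernel is an approximate identity, so any slice measure is the weak
limit of the u_r on its circle. This gives uniqueness, and with the existence bound it identifies
‖μ_ζ‖ with the lower limit (`IsSliceMeasure.cNorm_eq_liminf`), hence measurability and integrability
of the norm.

For the decomposition, ∫ f u_r dσ is evaluated in two ways (`isDecomposition_sliceMeasure`): it
tends to ∫ f dμ because the invariant Poisson kernel is an approximate identity; integrated circle
by circle it tends to the integral of ∫ f dμ_ζ, by dominated convergence with majorant ‖f‖‖μ_ζ‖. -/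

namespace SliceDecomposition

open Filter Topology

/-! ### Integration against complex measures, and comparison of total variations. -/

section ComplexMeasure

variable {X : Type*} [MeasurableSpace X]

instance isFiniteMeasure_variation (ν : ComplexMeasure X) : IsFiniteMeasure ν.variation := by
  have h : ν.variation ≤ ν.re.variation + ν.im.variation := by
    refine VectorMeasure.variation_le_of_forall_enorm_le fun E _ => ?_
    have h1 : ‖ν E‖ₑ ≤ ‖(ν E).re‖ₑ + ‖(ν E).im‖ₑ := by
      rw [← enorm_norm (ν E), Real.enorm_eq_ofReal (norm_nonneg _), Real.enorm_eq_ofReal_abs,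
        Real.enorm_eq_ofReal_abs, ← ENNReal.ofReal_add (abs_nonneg _) (abs_nonneg _)]
      exact ENNReal.ofReal_le_ofReal (Complex.norm_le_abs_re_add_abs_im _)
    exact h1.trans (add_le_add (VectorMeasure.enorm_measure_le_variation ν.re E)
      (VectorMeasure.enorm_measure_le_variation ν.im E))
  rw [← SignedMeasure.totalVariation_eq_variation, ← SignedMeasure.totalVariation_eq_variation] at h
  exact isFiniteMeasure_of_le _ h

theorem norm_cIntegral_le (ν : ComplexMeasure X) (f : X → ℂ) :
    ‖cIntegral ν f‖ ≤ ∫ x, ‖f x‖ ∂ν.variation := by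
  have h := VectorMeasure.norm_integral_le_integral_norm (μ := ν)
    (B := ContinuousLinearMap.mul ℝ ℂ) (f := f)
  rwa [ContinuousLinearMap.opNorm_mul, one_mul] at h

theorem cIntegral_add (ν : ComplexMeasure X) {f g : X → ℂ} (hf : Integrable f ν.variation)
    (hg : Integrable g ν.variation) :
    cIntegral ν (fun x => f x + g x) = cIntegral ν f + cIntegral ν g :=
  VectorMeasure.integral_fun_add hf hg

theorem cIntegral_sub (ν : ComplexMeasure X) {f g : X → ℂ} (hf : Integrable f ν.variation)
    (hg : Integrable g ν.variation) :
    cIntegral ν (fun x => f x - g x) = cIntegral ν f - cIntegral ν g :=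
  VectorMeasure.integral_fun_sub hf hg

/-- The pairing in `cIntegral` is only real-bilinear, so complex homogeneity has to be read off from
its values on sets. -/
theorem cIntegral_const_mul (ν : ComplexMeasure X) (c : ℂ) (f : X → ℂ) :
    cIntegral ν (fun x => c * f x) = c * cIntegral ν f := by
  simp only [cIntegral, VectorMeasure.integral_eq_setToFun]
  refine setToFun_smul _ (fun c s x => ?_) c f
  change (c * x) * ν s = c * (x * ν s)
  ring

theorem cIntegral_sub_measure (ν ν' : ComplexMeasure X) {f : X → ℂ}
    (hf : Integrable f ν.variation) (hf' : Integrable f ν'.variation) :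
    cIntegral (ν - ν') f = cIntegral ν f - cIntegral ν' f :=
  VectorMeasure.integral_sub_vectorMeasure hf hf'

theorem cIntegral_indicator (ν : ComplexMeasure X) (c : ℂ) {s : Set X} (hs : MeasurableSet s) :
    cIntegral ν (s.indicator fun _ => c) = c * ν s := by
  have := VectorMeasure.integral_indicator (μ := ν) (B := ContinuousLinearMap.mul ℝ ℂ)
    (f := fun _ => c) hs
  rw [cIntegral, this, VectorMeasure.integral_const]
  simp [VectorMeasure.restrict_apply _ hs]

theorem cIntegral_simpleFunc (ν : ComplexMeasure X) (f : SimpleFunc X ℂ) :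
    cIntegral ν f = ∑ c ∈ f.range, c * ν (f ⁻¹' {c}) := by
  classical
  have h : (f : X → ℂ) = fun x => ∑ c ∈ f.range, (f ⁻¹' {c}).indicator (fun _ => c) x := by
    ext x
    rw [Finset.sum_eq_single (f x)]
    · simp
    · intro c _ hc
      exact Set.indicator_of_notMem (fun h => hc h.symm) _
    · intro h
      exact absurd (f.mem_range_self x) h
  conv_lhs => rw [h]
  rw [cIntegral, VectorMeasure.integral_finsetSum]
  · exact Finset.sum_congr rfl fun c _ => cIntegral_indicator ν c (f.measurableSet_fiber c)
  · exact fun c _ => (integrable_const c).indicator (f.measurableSet_fiber c)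

theorem cIntegral_withDensity (m : Measure X) {g : X → ℂ} (hg : Integrable g m) {f : X → ℂ}
    (hf : Measurable f) {C : ℝ} (hC : ∀ x, ‖f x‖ ≤ C) :
    cIntegral (m.withDensityᵥ g) f = ∫ x, f x * g x ∂m := by
  set F : ℕ → SimpleFunc X ℂ := SimpleFunc.approxOn f hf Set.univ 0 (Set.mem_univ _) with hF
  -- The approximants satisfy ‖F n x‖ ≤ ‖f x‖ + ‖f x‖, which gives one constant majorant for
  -- dominated convergence on both sides.
  have hbd : ∀ n x, ‖F n x‖ ≤ C + C := fun n x =>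
    (SimpleFunc.norm_approxOn_zero_le hf (Set.mem_univ _) x n).trans (add_le_add (hC x) (hC x))
  have hlim : ∀ x, Tendsto (fun n => F n x) atTop (𝓝 (f x)) := fun x =>
    SimpleFunc.tendsto_approxOn hf (Set.mem_univ _) (by simp)
  have h1 : Tendsto (fun n => cIntegral (m.withDensityᵥ g) (F n)) atTop
      (𝓝 (cIntegral (m.withDensityᵥ g) f)) :=
    VectorMeasure.tendsto_integral_of_dominated_convergence (fun _ => C + C)
      (fun n => (F n).measurable.aestronglyMeasurable) (integrable_const _)
      (fun n => .of_forall (hbd n)) (.of_forall hlim)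
  have h2 : Tendsto (fun n => ∫ x, F n x * g x ∂m) atTop (𝓝 (∫ x, f x * g x ∂m)) := by
    refine tendsto_integral_of_dominated_convergence (fun x => (C + C) * ‖g x‖)
      (fun n => (F n).measurable.aestronglyMeasurable.mul hg.1) (hg.norm.const_mul _)
      (fun n => .of_forall fun x => ?_) (.of_forall fun x => (hlim x).mul_const _)
    rw [norm_mul]
    exact mul_le_mul_of_nonneg_right (hbd n x) (norm_nonneg _)
  refine tendsto_nhds_unique h1 (h2.congr fun n => ?_)
  rw [cIntegral_simpleFunc]
  have h : ∀ x, F n x * g x = ∑ c ∈ (F n).range, (F n ⁻¹' {c}).indicator (fun x => c * g x) x := by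
    intro x
    rw [Finset.sum_eq_single (F n x)]
    · simp
    · intro c _ hc
      exact Set.indicator_of_notMem (fun h => hc h.symm) _
    · intro h
      exact absurd ((F n).mem_range_self x) h
  simp_rw [h]
  rw [integral_finsetSum]
  · refine Finset.sum_congr rfl fun c _ => ?_
    rw [integral_indicator ((F n).measurableSet_fiber c), integral_const_mul,
      withDensityᵥ_apply hg ((F n).measurableSet_fiber c)]
  · exact fun c _ => (hg.const_mul c).indicator ((F n).measurableSet_fiber c)

variable [TopologicalSpace X] [BorelSpace X]

theorem integrable_of_continuous [CompactSpace X] {E : Type*} [NormedAddCommGroup E]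
    [SecondCountableTopology E]
    (m : Measure X) [IsFiniteMeasure m] {f : X → E} (hf : Continuous f) : Integrable f m := by
  borelize E
  obtain ⟨C, hC⟩ := (isCompact_range hf).isBounded.exists_norm_le
  exact Integrable.of_bound hf.measurable.aestronglyMeasurable C
    (.of_forall fun x => hC _ (Set.mem_range_self x))

/-- Continuous functions approximate the indicator of a Borel set in L¹ of `ν.variation + m`, so a
single approximant controls the errors for both measures. -/
theorem variation_le_of_norm_cIntegral_le [CompactSpace X] [TopologicalSpace.PseudoMetrizableSpace X]
    (ν : ComplexMeasure X) (m : Measure X) [IsFiniteMeasure m]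
    (h : ∀ f : C(X, ℂ), ‖cIntegral ν f‖ ≤ ∫ x, ‖f x‖ ∂m) : ν.variation ≤ m := by
  refine VectorMeasure.variation_le_of_forall_enorm_le fun E hE => ?_
  rw [← ofReal_norm, ← ENNReal.ofReal_toReal (measure_ne_top m E)]
  refine ENNReal.ofReal_le_ofReal (le_of_forall_pos_le_add fun ε hε => ?_)
  have hI : Integrable (E.indicator fun _ => (1 : ℂ)) (ν.variation + m) :=
    (integrable_const 1).indicator hE
  obtain ⟨f, hf, -⟩ := hI.exists_boundedContinuous_integral_sub_le hε
  have hfν : Integrable f ν.variation := integrable_of_continuous _ f.continuous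
  have hfm : Integrable f m := integrable_of_continuous _ f.continuous
  have hIν := hI.left_of_add_measure
  have hIm := hI.right_of_add_measure
  have hsplit := integral_add_measure (hIν.sub hfν).norm (hIm.sub hfm).norm
  simp only [Pi.sub_apply] at hsplit
  rw [hsplit] at hf
  have h1 : ν E = cIntegral ν f + cIntegral ν (fun x => E.indicator (fun _ => (1 : ℂ)) x - f x) := by
    rw [cIntegral_sub ν hIν hfν, cIntegral_indicator ν 1 hE]
    ring
  have h2 : ∫ x, ‖f x‖ ∂m ≤ m.real E + ∫ x, ‖E.indicator (fun _ => (1 : ℂ)) x - f x‖ ∂m := by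
    have : ∫ x, ‖E.indicator (fun _ => (1 : ℂ)) x‖ ∂m = m.real E := by
      simp_rw [norm_indicator_eq_indicator_norm, norm_one]
      rw [integral_indicator hE]
      simp
    have hadd := integral_add hIm.norm (hIm.sub hfm).norm
    simp only [Pi.sub_apply] at hadd
    rw [← this, ← hadd]
    refine integral_mono hfm.norm (hIm.norm.add (hIm.sub hfm).norm) fun x => ?_
    simpa [norm_sub_rev] using norm_le_norm_add_norm_sub (E.indicator (fun _ => (1 : ℂ)) x) (f x)
  calc ‖ν E‖ ≤ ‖cIntegral ν f‖ + ‖cIntegral ν fun x => E.indicator (fun _ => (1 : ℂ)) x - f x‖ := by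
        rw [h1]; exact norm_add_le _ _
    _ ≤ ∫ x, ‖f x‖ ∂m + ∫ x, ‖E.indicator (fun _ => (1 : ℂ)) x - f x‖ ∂ν.variation :=
        add_le_add (h f.toContinuousMap) (norm_cIntegral_le _ _)
    _ ≤ (m E).toReal + ε := by
        have : m.real E = (m E).toReal := rfl
        linarith

theorem eq_of_cIntegral_eq [CompactSpace X] [TopologicalSpace.PseudoMetrizableSpace X]
    {ν ν' : ComplexMeasure X} (h : ∀ f : C(X, ℂ), cIntegral ν f = cIntegral ν' f) : ν = ν' := by
  rw [← sub_eq_zero, ← VectorMeasure.variation_eq_zero]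
  refine le_antisymm (variation_le_of_norm_cIntegral_le _ 0 fun f => ?_) (Measure.zero_le _)
  rw [cIntegral_sub_measure _ _ (integrable_of_continuous _ f.continuous)
    (integrable_of_continuous _ f.continuous), h f]
  simp

end ComplexMeasure

/-! ### Approximate identities for complex measures. -/

section Kernel

variable {X : Type*} [MetricSpace X] [CompactSpace X] [MeasurableSpace X] [BorelSpace X]

/-- Integration of continuous functions against a complex measure. -/
noncomputable def cIntegralCLM (ν : ComplexMeasure X) : C(X, ℂ) →L[ℂ] ℂ :=
  LinearMap.mkContinuous
    { toFun := fun f => cIntegral ν f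
      map_add' := fun f g => cIntegral_add ν (integrable_of_continuous _ f.continuous)
        (integrable_of_continuous _ g.continuous)
      map_smul' := fun c f => cIntegral_const_mul ν c f }
    (ν.variation.real Set.univ) (fun f => by
      refine (norm_cIntegral_le ν f).trans ?_
      calc ∫ x, ‖f x‖ ∂ν.variation ≤ ∫ _, ‖f‖ ∂ν.variation :=
            integral_mono (integrable_of_continuous _ f.continuous.norm) (integrable_const _)
              fun x => f.norm_coe_le_norm x
        _ = _ := by simp)

@[simp]
theorem cIntegralCLM_apply (ν : ComplexMeasure X) (f : C(X, ℂ)) :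
    cIntegralCLM ν f = cIntegral ν f := rfl

theorem continuous_cIntegral (ν : ComplexMeasure X) {Y : Type*} [TopologicalSpace Y]
    {F : Y → X → ℂ} (hF : Continuous fun p : Y × X => F p.1 p.2) :
    Continuous fun y => cIntegral ν (F y) := by
  set G : C(Y, C(X, ℂ)) := ContinuousMap.curry ⟨_, hF⟩ with hG
  have hGF : ∀ y, (G y : X → ℂ) = F y := fun y => rfl
  have h : Continuous fun y => cIntegralCLM ν (G y) :=
    (cIntegralCLM ν).continuous.comp G.continuous
  simpa only [cIntegralCLM_apply, hGF] using h

/-- Fubini for a complex measure: x ↦ F x is a continuous map into C(X, ℂ), and the bounded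
functional `cIntegralCLM ν` commutes with its Bochner integral. -/
theorem integral_cIntegral_swap (ν : ComplexMeasure X) (σ : Measure X) [IsFiniteMeasure σ]
    {F : X → X → ℂ} (hF : Continuous fun p : X × X => F p.1 p.2) :
    ∫ x, cIntegral ν (F x) ∂σ = cIntegral ν fun y => ∫ x, F x y ∂σ := by
  set G : C(X, C(X, ℂ)) := ContinuousMap.curry ⟨_, hF⟩ with hG
  obtain ⟨C, hC⟩ := (isCompact_range G.continuous).isBounded.exists_norm_le
  have hi : Integrable G σ :=
    Integrable.of_bound G.continuous.aestronglyMeasurable C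
      (.of_forall fun x => hC _ (Set.mem_range_self x))
  have h1 := (cIntegralCLM ν).integral_comp_comm hi
  have h2 : ∀ y, (∫ x, G x ∂σ) y = ∫ x, F x y ∂σ := fun y =>
    ((ContinuousMap.evalCLM ℂ y).integral_comp_comm hi).symm
  have h3 : ((∫ x, G x ∂σ : C(X, ℂ)) : X → ℂ) = fun y => ∫ x, F x y ∂σ := funext h2
  rw [cIntegralCLM_apply, h3] at h1
  exact h1

/-- A sequence of nonnegative continuous kernels that acts as an approximate identity on the
complex measure `ν`, with respect to integration against `σ` in the first variable. -/
structure IsApproxKernel (σ : Measure X) (ν : ComplexMeasure X) (K : ℕ → X → X → ℝ) : Prop where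
  continuous : ∀ n, Continuous fun p : X × X => K n p.1 p.2
  nonneg : ∀ n x y, 0 ≤ K n x y
  integral_eq_one : ∀ n, ∀ᵐ y ∂ν.variation, ∫ x, K n x y ∂σ = 1
  concentrated : ∀ δ > 0, ∀ ε > 0, ∀ᶠ n in atTop, ∀ x y, δ ≤ dist x y → K n x y ≤ ε

variable {σ : Measure X} [IsProbabilityMeasure σ] {ν : ComplexMeasure X} {K : ℕ → X → X → ℝ}

theorem IsApproxKernel.integral_norm_le (hK : IsApproxKernel σ ν K) (n : ℕ) :
    ∫ x, ‖cIntegral ν fun y => (K n x y : ℂ)‖ ∂σ ≤ ν.variation.real Set.univ := by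
  have hc := hK.continuous n
  have hc1 : Continuous fun x => cIntegral ν fun y => (K n x y : ℂ) :=
    continuous_cIntegral ν (Complex.continuous_ofReal.comp hc)
  have hi : Integrable (fun p : X × X => K n p.1 p.2) (σ.prod ν.variation) :=
    integrable_of_continuous _ hc
  calc ∫ x, ‖cIntegral ν fun y => (K n x y : ℂ)‖ ∂σ
      ≤ ∫ x, ∫ y, K n x y ∂ν.variation ∂σ := by
        refine integral_mono (integrable_of_continuous _ hc1.norm) hi.integral_prod_left
          fun x => (norm_cIntegral_le _ _).trans_eq ?_
        simp [abs_of_nonneg (hK.nonneg n _ _)]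
    _ = ∫ y, ∫ x, K n x y ∂σ ∂ν.variation := integral_integral_swap hi
    _ = ∫ _, 1 ∂ν.variation := integral_congr_ae (hK.integral_eq_one n)
    _ = ν.variation.real Set.univ := by simp

/-- After exchanging the integrals, the inner one tends to f(y) for almost every y and is bounded by
sup |f|, so dominated convergence applies. -/
theorem IsApproxKernel.tendsto_integral (hK : IsApproxKernel σ ν K) (f : C(X, ℂ)) :
    Tendsto (fun n => ∫ x, f x * cIntegral ν (fun y => (K n x y : ℂ)) ∂σ) atTop
      (𝓝 (cIntegral ν f)) := by
  have hFc : ∀ n, Continuous fun p : X × X => f p.1 * (K n p.1 p.2 : ℂ) := fun n =>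
    (f.continuous.comp continuous_fst).mul (Complex.continuous_ofReal.comp (hK.continuous n))
  have h1 : ∀ n, ∫ x, f x * cIntegral ν (fun y => (K n x y : ℂ)) ∂σ =
      cIntegral ν fun y => ∫ x, f x * K n x y ∂σ := fun n => by
    simp_rw [← cIntegral_const_mul]
    exact integral_cIntegral_swap ν σ (hFc n)
  simp_rw [h1]
  obtain ⟨C, hC⟩ := (isCompact_range f.continuous).isBounded.exists_norm_le
  have hC : ∀ x, ‖f x‖ ≤ C := fun x => hC _ (Set.mem_range_self x)
  have hfm : ∀ n, AEStronglyMeasurable (fun y => ∫ x, f x * K n x y ∂σ) ν.variation := fun n =>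
    (integrable_of_continuous (ν.variation.prod σ)
      ((hFc n).comp continuous_swap)).integral_prod_left.1
  have hKx : ∀ n y, Continuous fun x => K n x y := fun n y =>
    (hK.continuous n).comp (Continuous.prodMk_left y)
  refine VectorMeasure.tendsto_integral_of_dominated_convergence (fun _ => C) hfm
    (integrable_const C) (fun n => ?_) ?_
  · filter_upwards [hK.integral_eq_one n] with y hy
    calc ‖∫ x, f x * K n x y ∂σ‖ ≤ ∫ x, C * K n x y ∂σ := by
          refine norm_integral_le_of_norm_le
            (integrable_of_continuous _ ((hKx n y).const_mul C)) (.of_forall fun x => ?_)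
          rw [norm_mul, Complex.norm_of_nonneg (hK.nonneg n x y)]
          exact mul_le_mul_of_nonneg_right (hC x) (hK.nonneg n x y)
      _ = C := by rw [integral_const_mul, hy, mul_one]
  · filter_upwards [ae_all_iff.2 hK.integral_eq_one] with y hy
    rw [Metric.tendsto_atTop']
    intro ε hε
    obtain ⟨δ, hδ, hfδ⟩ := Metric.continuous_iff.1 f.continuous y (ε / 2) (half_pos hε)
    have hC0 : 0 ≤ C := (norm_nonneg _).trans (hC y)
    -- Far from y the factor |f x - f y| is at most 2C, so this kernel bound makes the far part at
    -- most ε/4; the summand 1 covers C = 0.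
    have hη : 0 < ε / (4 * (2 * C + 1)) := by positivity
    obtain ⟨N, hN⟩ := eventually_atTop.1 (hK.concentrated δ hδ _ hη)
    refine ⟨N, fun n hn => ?_⟩
    have hsub : ∫ x, f x * K n x y ∂σ - f y = ∫ x, (f x - f y) * K n x y ∂σ := by
      have h2 : ∫ x, f y * (K n x y : ℂ) ∂σ = f y := by
        rw [integral_const_mul, integral_complex_ofReal, hy n]; simp
      conv_lhs => rw [← h2]
      have hc1 : Continuous fun x => f x * (K n x y : ℂ) :=
        f.continuous.mul (Complex.continuous_ofReal.comp (hKx n y))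
      have hc2 : Continuous fun x => f y * (K n x y : ℂ) :=
        continuous_const.mul (Complex.continuous_ofReal.comp (hKx n y))
      rw [← integral_sub (integrable_of_continuous _ hc1) (integrable_of_continuous _ hc2)]
      simp_rw [sub_mul]
    rw [dist_eq_norm, hsub]
    calc ‖∫ x, (f x - f y) * K n x y ∂σ‖
        ≤ ∫ x, (ε / 2 * K n x y + 2 * C * (ε / (4 * (2 * C + 1)))) ∂σ := by
          refine norm_integral_le_of_norm_le
            (integrable_of_continuous _ (((hKx n y).const_mul _).add continuous_const))
            (.of_forall fun x => ?_)
          rw [norm_mul, Complex.norm_of_nonneg (hK.nonneg n x y)]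
          rcases lt_or_ge (dist x y) δ with hx | hx
          · have h3 := mul_le_mul_of_nonneg_right (hfδ x hx).le (hK.nonneg n x y)
            rw [dist_eq_norm] at h3
            have : 0 ≤ 2 * C * (ε / (4 * (2 * C + 1))) := by positivity
            linarith
          · have h3 : ‖f x - f y‖ ≤ 2 * C := (norm_sub_le _ _).trans (by linarith [hC x, hC y])
            have h4 := mul_le_mul h3 (hN n hn.le x y hx) (hK.nonneg n x y) (by positivity)
            have : 0 ≤ ε / 2 * K n x y := mul_nonneg (by positivity) (hK.nonneg n x y)
            linarith
      _ = ε / 2 + 2 * C * (ε / (4 * (2 * C + 1))) := by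
          rw [integral_add (integrable_of_continuous _ ((hKx n y).const_mul _))
            (integrable_const _), integral_const_mul, hy n]
          simp
      _ < ε := by
          have : 2 * C * (ε / (4 * (2 * C + 1))) ≤ ε / 4 := by
            rw [mul_div_assoc', div_le_div_iff₀ (by positivity) (by positivity)]
            nlinarith
          linarith

end Kernel

/-! ### Weak limits of L¹-bounded sequences of densities. -/

section WeakLimit

theorem exists_tendsto_of_norm_le {E : Type*} [SeminormedAddCommGroup E] [ProperSpace E]
    (U : Ultrafilter ℕ) {a : ℕ → E} {C : ℝ} (h : ∀ᶠ n in (U : Filter ℕ), ‖a n‖ ≤ C) :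
    ∃ l, Tendsto a U (𝓝 l) := by
  have hm : closedBall (0 : E) C ∈ U.map a :=
    Ultrafilter.mem_map.2 (h.mono fun n hn => by simpa using hn)
  obtain ⟨l, -, hl⟩ := (isCompact_closedBall (0 : E) C).ultrafilter_le_nhds' (U.map a) hm
  exact ⟨l, hl⟩

variable {X : Type*} [MetricSpace X] [CompactSpace X] [MeasurableSpace X] [BorelSpace X]

/-- Limits along an ultrafilter exist for every test function at once and define a positive
functional, which Riesz–Markov represents. -/
theorem exists_measure_tendsto_integral (σ : Measure X) [IsFiniteMeasure σ] (U : Ultrafilter ℕ)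
    {k : ℕ → X → ℝ} (hk : ∀ n, Continuous (k n)) (hk0 : ∀ n x, 0 ≤ k n x) {c : ℝ}
    (hc : ∀ᶠ n in (U : Filter ℕ), ∫ x, k n x ∂σ ≤ c) :
    ∃ m : Measure X, IsFiniteMeasure m ∧ ∀ f : C(X, ℝ),
      Tendsto (fun n => ∫ x, f x * k n x ∂σ) U (𝓝 (∫ x, f x ∂m)) := by
  have hi : ∀ (f : C(X, ℝ)) n, Integrable (fun x => f x * k n x) σ := fun f n =>
    integrable_of_continuous _ (f.continuous.mul (hk n))
  have hex : ∀ f : C(X, ℝ), ∃ l, Tendsto (fun n => ∫ x, f x * k n x ∂σ) U (𝓝 l) := fun f => by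
    refine exists_tendsto_of_norm_le U (C := ‖f‖ * c) ?_
    filter_upwards [hc] with n hn
    calc ‖∫ x, f x * k n x ∂σ‖ ≤ ∫ x, ‖f‖ * k n x ∂σ := by
          refine norm_integral_le_of_norm_le
            (integrable_of_continuous _ ((hk n).const_mul _)) (.of_forall fun x => ?_)
          rw [norm_mul, Real.norm_of_nonneg (hk0 n x)]
          exact mul_le_mul_of_nonneg_right (f.norm_coe_le_norm x) (hk0 n x)
      _ ≤ ‖f‖ * c := by
          rw [integral_const_mul]
          exact mul_le_mul_of_nonneg_left hn (norm_nonneg _)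
  choose l hl using hex
  have hU : (U : Filter ℕ).NeBot := U.neBot
  let T : CompactlySupportedContinuousMap X ℝ →ₗ[ℝ] ℝ :=
    { toFun := fun f => l f
      map_add' := fun f g => by
        refine tendsto_nhds_unique (hl _) (((hl f).add (hl g)).congr fun n => ?_)
        rw [← integral_add (hi _ n) (hi _ n)]
        refine integral_congr_ae (.of_forall fun x => ?_)
        exact (add_mul _ _ _).symm
      map_smul' := fun c f => by
        refine tendsto_nhds_unique (hl _) (((hl f).const_mul c).congr fun n => ?_)
        rw [← integral_const_mul]
        refine integral_congr_ae (.of_forall fun x => ?_)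
        exact (mul_assoc _ _ _).symm }
  let Λ : CompactlySupportedContinuousMap X ℝ →ₚ[ℝ] ℝ := PositiveLinearMap.mk₀ T fun f hf =>
    ge_of_tendsto' (hl f) fun n => integral_nonneg fun x => mul_nonneg (hf x) (hk0 n x)
  refine ⟨RealRMK.rieszMeasure Λ, inferInstance, fun f => ?_⟩
  let f' : CompactlySupportedContinuousMap X ℝ := ⟨f, HasCompactSupport.of_compactSpace _⟩
  have h := RealRMK.integral_rieszMeasure Λ f'
  have h' : ∫ x, f x ∂(RealRMK.rieszMeasure Λ) = l f := h
  rw [h']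
  exact hl f

/-- A linear functional dominated by an `L¹` norm is given by a complex measure with an integrable
density. -/
theorem exists_density_of_norm_le (m : Measure X) [IsFiniteMeasure m] (L : C(X, ℂ) →ₗ[ℂ] ℂ)
    (hL : ∀ f, ‖L f‖ ≤ ∫ x, ‖f x‖ ∂m) :
    ∃ g : X → ℂ, Integrable g m ∧ ∀ f : C(X, ℂ), L f = cIntegral (m.withDensityᵥ g) f := by
  -- Since `m` is finite, its L¹ norm is bounded by a multiple of its L² norm. Hence `L` extends to
  -- L², and the Riesz–Fréchet theorem represents it by an inner product; the density is the
  -- conjugate of the representing vector.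
  set e : C(X, ℂ) →L[ℂ] Lp ℂ 2 m := ContinuousMap.toLp 2 m ℂ with he
  have hd : DenseRange e := ContinuousMap.toLp_denseRange ℂ m ℂ (by simp)
  have hb : ∀ f, ‖L f‖ ≤ (m Set.univ ^ (1 / 2 : ℝ)).toReal * ‖e f‖ := fun f => by
    refine (hL f).trans ?_
    have hfm : AEStronglyMeasurable f m := f.continuous.aestronglyMeasurable
    have h1 := eLpNorm_le_eLpNorm_mul_rpow_measure_univ (p := 1) (q := 2) (by norm_num) hfm
    have h2 : eLpNorm (e f) 2 m = eLpNorm f 2 m :=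
      eLpNorm_congr_ae (ContinuousMap.coeFn_toLp (𝕜 := ℂ) m f)
    have h3 : (1 / (1 : ENNReal).toReal - 1 / (2 : ENNReal).toReal : ℝ) = 1 / 2 := by norm_num
    rw [h3] at h1
    have h4 : ENNReal.ofReal (∫ x, ‖f x‖ ∂m) = eLpNorm f 1 m := by
      rw [eLpNorm_one_eq_lintegral_enorm,
        ofReal_integral_norm_eq_lintegral_enorm (integrable_of_continuous m f.continuous)]
    have hfin : eLpNorm f 2 m * m Set.univ ^ (1 / 2 : ℝ) ≠ ⊤ := by
      refine ENNReal.mul_ne_top ?_ (ENNReal.rpow_ne_top_of_nonneg (by norm_num) (measure_ne_top _ _))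
      rw [← h2]
      exact Lp.eLpNorm_ne_top _
    rw [← h4, ENNReal.ofReal_le_iff_le_toReal hfin, ENNReal.toReal_mul] at h1
    rw [Lp.norm_def, h2, mul_comm]
    exact h1
  have hbe : ∃ C, ∀ f, ‖L f‖ ≤ C * ‖(e : C(X, ℂ) →ₗ[ℂ] Lp ℂ 2 m) f‖ := ⟨_, hb⟩
  set T : Lp ℂ 2 m →L[ℂ] ℂ := L.extendOfNorm (e : C(X, ℂ) →ₗ[ℂ] Lp ℂ 2 m) with hT
  set g : Lp ℂ 2 m := (InnerProductSpace.toDual ℂ (Lp ℂ 2 m)).symm T with hg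
  have hgi : Integrable (fun x => (starRingEnd ℂ) (g x)) m := by
    have := (Lp.memLp g).integrable (by norm_num)
    exact (Complex.conjCLE.toContinuousLinearMap.integrable_comp this)
  refine ⟨_, hgi, fun f => ?_⟩
  obtain ⟨C, hC⟩ := (isCompact_range f.continuous).isBounded.exists_norm_le
  rw [cIntegral_withDensity m hgi f.continuous.measurable fun x => hC _ (Set.mem_range_self x)]
  have h1 : T (e f) = L f := LinearMap.extendOfNorm_eq (f := L)
    (e := (e : C(X, ℂ) →ₗ[ℂ] Lp ℂ 2 m)) hd hbe f
  have h2 : inner ℂ g (e f) = T (e f) := InnerProductSpace.toDual_symm_apply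
  rw [← h1, ← h2, L2.inner_def]
  refine integral_congr_ae ?_
  filter_upwards [ContinuousMap.coeFn_toLp (𝕜 := ℂ) (p := 2) m f] with x hx
  have hx' : (e f) x = f x := hx
  rw [hx', RCLike.inner_apply]

/-- The positive densities |h_n| have a weak limit m, and the limit functional of the h_n is
dominated by the L¹(m) norm. The representing measure then has variation at most m, so both its mass
and its support are controlled by m. -/
theorem exists_complexMeasure_tendsto_integral (σ : Measure X) [IsFiniteMeasure σ]
    {h : ℕ → X → ℂ} (hh : ∀ n, Continuous (h n)) {c : ℝ}
    (hc : ∃ᶠ n in atTop, ∫ x, ‖h n x‖ ∂σ ≤ c) {S : Set X} (hS : IsClosed S) (hσS : σ Sᶜ = 0) :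
    ∃ ν : ComplexMeasure X, ∃ U : Filter ℕ, U.NeBot ∧ U ≤ atTop ∧
      ν.variation Set.univ ≤ ENNReal.ofReal c ∧ ν.variation Sᶜ = 0 ∧
      ∀ f : C(X, ℂ), Tendsto (fun n => ∫ x, f x * h n x ∂σ) U (𝓝 (cIntegral ν f)) := by
  have hne : (atTop ⊓ 𝓟 {n | ∫ x, ‖h n x‖ ∂σ ≤ c} : Filter ℕ).NeBot :=
    frequently_mem_iff_neBot.1 hc
  -- The bound holds only for infinitely many n, so the ultrafilter is chosen to live on those
  -- indices.
  set U : Ultrafilter ℕ := Ultrafilter.of (atTop ⊓ 𝓟 {n | ∫ x, ‖h n x‖ ∂σ ≤ c}) with hUdef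
  have hU1 : (U : Filter ℕ) ≤ atTop := (Ultrafilter.of_le _).trans inf_le_left
  have hU2 : ∀ᶠ n in (U : Filter ℕ), ∫ x, ‖h n x‖ ∂σ ≤ c :=
    (Ultrafilter.of_le _).trans inf_le_right (mem_principal_self _)
  have hU : (U : Filter ℕ).NeBot := U.neBot
  obtain ⟨m, hm, hlim⟩ := exists_measure_tendsto_integral σ U (fun n => (hh n).norm)
    (fun n x => norm_nonneg _) hU2
  have hi : ∀ (f : C(X, ℂ)) n, Integrable (fun x => f x * h n x) σ := fun f n =>
    integrable_of_continuous _ (f.continuous.mul (hh n))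
  have hle : ∀ (f : C(X, ℂ)) n, ‖∫ x, f x * h n x ∂σ‖ ≤ ∫ x, ‖f x‖ * ‖h n x‖ ∂σ := fun f n =>
    (norm_integral_le_integral_norm _).trans_eq (by simp_rw [norm_mul])
  have hnorm : ∀ f : C(X, ℂ), Tendsto (fun n => ∫ x, ‖f x‖ * ‖h n x‖ ∂σ) U
      (𝓝 (∫ x, ‖f x‖ ∂m)) := fun f => hlim ⟨_, f.continuous.norm⟩
  have hex : ∀ f : C(X, ℂ), ∃ l, Tendsto (fun n => ∫ x, f x * h n x ∂σ) U (𝓝 l) := fun f => by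
    refine exists_tendsto_of_norm_le U (C := ∫ x, ‖f x‖ ∂m + 1) ?_
    filter_upwards [(hnorm f).eventually (gt_mem_nhds (lt_add_one _))] with n hn
    exact (hle f n).trans hn.le
  choose l hl using hex
  let L : C(X, ℂ) →ₗ[ℂ] ℂ :=
    { toFun := l
      map_add' := fun f g => by
        refine tendsto_nhds_unique (hl _) (((hl f).add (hl g)).congr fun n => ?_)
        rw [← integral_add (hi _ n) (hi _ n)]
        refine integral_congr_ae (.of_forall fun x => ?_)
        exact (add_mul _ _ _).symm
      map_smul' := fun c f => by
        refine tendsto_nhds_unique (hl _) (((hl f).const_mul c).congr fun n => ?_)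
        rw [← integral_const_mul]
        refine integral_congr_ae (.of_forall fun x => ?_)
        exact (mul_assoc _ _ _).symm }
  have hL : ∀ f, ‖L f‖ ≤ ∫ x, ‖f x‖ ∂m := fun f =>
    le_of_tendsto_of_tendsto' (hl f).norm (hnorm f) (hle f)
  obtain ⟨g, -, hgL⟩ := exists_density_of_norm_le m L hL
  have hvar : (m.withDensityᵥ g).variation ≤ m :=
    variation_le_of_norm_cIntegral_le _ _ fun f => hgL f ▸ hL f
  refine ⟨m.withDensityᵥ g, U, hU, hU1, (hvar _).trans ?_, ?_, fun f => hgL f ▸ hl f⟩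
  · have h1 := le_of_tendsto (hlim (ContinuousMap.const X 1)) (b := c) (by simpa using hU2)
    have h2 : m.real Set.univ ≤ c := by simpa using h1
    rw [← ENNReal.ofReal_toReal (measure_ne_top m Set.univ)]
    exact ENNReal.ofReal_le_ofReal h2
  · refine le_antisymm ((hvar _).trans ?_) zero_le
    -- The distance to S is a continuous test function that vanishes exactly on S when S is
    -- nonempty, so its m-integral being zero forces m to live on S.
    have hd : Continuous fun x => infDist x S := continuous_infDist_pt S
    rcases S.eq_empty_or_nonempty with rfl | hne
    · have hσ : σ = 0 := by simpa using hσS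
      have h1 := tendsto_nhds_unique (hlim (ContinuousMap.const X 1))
        (by simp [hσ] : Tendsto _ _ (𝓝 (0 : ℝ)))
      have h2 : m.real Set.univ = 0 := by simpa using h1
      rw [Set.compl_empty, (measureReal_eq_zero_iff).1 h2]
    · have h0 : ∫ x, infDist x S ∂m = 0 := by
        refine tendsto_nhds_unique (hlim ⟨_, hd⟩) (tendsto_const_nhds.congr fun n => ?_)
        refine (integral_eq_zero_of_ae ?_).symm
        filter_upwards [compl_mem_ae_iff.2 hσS] with x hx
        rw [compl_compl] at hx
        simp [infDist_zero_of_mem hx]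
      have h1 := (integral_eq_zero_iff_of_nonneg (fun x => infDist_nonneg)
        (integrable_of_continuous m hd)).1 h0
      refine le_of_eq (measure_mono_null ?_ h1)
      intro x hx hx0
      exact hx ((hS.mem_iff_infDist_zero hne).2 hx0)

end WeakLimit

/-! ### Moments of a coordinate on the complex sphere, from Gaussian integrals. -/

section Sphere

/-- Polar coordinates for an integrand that separates into an angular and a radial factor. -/
theorem integral_eq_toSphere_mul {E : Type*} [NormedAddCommGroup E] [NormedSpace ℝ E]
    [Nontrivial E] [FiniteDimensional ℝ E] [MeasurableSpace E] [BorelSpace E] (μ : Measure E)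
    [μ.IsAddHaarMeasure] {F : E → ℝ} {g : sphere (0 : E) 1 → ℝ} {φ : ℝ → ℝ}
    (h : ∀ (s : sphere (0 : E) 1) (r : ℝ), 0 < r → F (r • (s : E)) = g s * φ r) :
    ∫ x, F x ∂μ = (∫ s, g s ∂μ.toSphere) *
      ∫ r in Set.Ioi (0 : ℝ), r ^ (Module.finrank ℝ E - 1) * φ r := by
  calc
    ∫ x, F x ∂μ = ∫ x : ({(0)}ᶜ : Set E), F x ∂(μ.comap (↑)) := by
      rw [integral_subtype_comap (measurableSet_singleton _).compl F,
        restrict_compl_singleton]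
    _ = ∫ x : sphere (0 : E) 1 × Set.Ioi (0 : ℝ), g x.1 * φ x.2
          ∂μ.toSphere.prod (.volumeIoiPow (Module.finrank ℝ E - 1)) := by
      rw [← μ.measurePreserving_homeomorphUnitSphereProd.integral_comp
        (Homeomorph.measurableEmbedding _)]
      refine integral_congr_ae (.of_forall fun x => ?_)
      have hx := h ((homeomorphUnitSphereProd E x).1) ((homeomorphUnitSphereProd E x).2)
        (homeomorphUnitSphereProd E x).2.2
      refine Eq.trans ?_ hx
      have : (((homeomorphUnitSphereProd E x).2 : ℝ)) • ((homeomorphUnitSphereProd E x).1 : E) =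
          (x : E) := by
        have hx0 : ‖(x : E)‖ ≠ 0 := norm_ne_zero_iff.2 x.2
        simp [smul_smul, hx0]
      rw [this]
    _ = (∫ s, g s ∂μ.toSphere) *
          ∫ x : Set.Ioi (0 : ℝ), φ x ∂.volumeIoiPow (Module.finrank ℝ E - 1) :=
      integral_prod_mul g fun x : Set.Ioi (0 : ℝ) => φ x
    _ = _ := by
      congr 1
      simp only [Measure.volumeIoiPow, ENNReal.ofReal]
      rw [integral_withDensity_eq_integral_smul,
        integral_subtype_comap measurableSet_Ioi
          fun a ↦ Real.toNNReal (a ^ (Module.finrank ℝ E - 1)) • φ a,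
        setIntegral_congr_fun measurableSet_Ioi fun x hx ↦ ?_]
      · rw [NNReal.smul_def, Real.coe_toNNReal _ (pow_nonneg hx.out.le _), smul_eq_mul]
      · exact (measurable_subtype_coe.pow_const _).real_toNNReal

/-- Both volumes are Haar measures. The value of the constant is immaterial, as it cancels when σ is
normalized. -/
theorem integral_eq_const_mul_integral_pi (d : ℕ) : ∃ c : ℝ, 0 < c ∧ ∀ F : Cn d → ℝ,
    ∫ x, F x = c * ∫ y : Fin d → ℂ, F (WithLp.toLp 2 y) := by
  set e : Cn d ≃L[ℝ] (Fin d → ℂ) := PiLp.continuousLinearEquiv 2 ℝ fun _ => ℂ with he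
  have : ((volume : Measure (Fin d → ℂ)).map e.symm).IsAddHaarMeasure :=
    e.symm.isAddHaarMeasure_map _
  obtain ⟨c, hc0, hct, hc⟩ : ∃ c : ENNReal, c ≠ 0 ∧ c ≠ ⊤ ∧
      (volume : Measure (Cn d)) = c • (volume : Measure (Fin d → ℂ)).map e.symm := by
    set c := Measure.addHaarScalarFactor (volume : Measure (Cn d))
      ((volume : Measure (Fin d → ℂ)).map e.symm) with hc
    refine ⟨c, ?_, ENNReal.coe_ne_top, ?_⟩
    · exact_mod_cast (Measure.addHaarScalarFactor_pos_of_isAddHaarMeasure _ _).ne'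
    · exact Measure.isAddLeftInvariant_eq_smul _ _
  refine ⟨c.toReal, ENNReal.toReal_pos hc0 hct, fun F => ?_⟩
  conv_lhs => rw [hc]
  rw [integral_smul_measure, smul_eq_mul]
  congr 1
  exact (e.symm.toHomeomorph.measurableEmbedding.integral_map F)

theorem integral_norm_pow_mul_exp (n : ℕ) :
    ∫ z : ℂ, ‖z‖ ^ (2 * n) * Real.exp (-‖z‖ ^ 2) = Real.pi * n.factorial := by
  have h := Complex.integral_rpow_mul_exp_neg_rpow (p := 2) (q := 2 * n) (by norm_num)
    (by have : (0 : ℝ) ≤ n := n.cast_nonneg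
        linarith)
  have e1 : ((2 * n : ℝ) + 2) / 2 = n + 1 := by ring
  rw [e1, Real.Gamma_nat_eq_factorial] at h
  rw [show 2 * Real.pi / 2 = Real.pi by ring] at h
  rw [← h]
  refine integral_congr_ae (.of_forall fun z => ?_)
  simp only
  rw [show (2 * n : ℝ) = ((2 * n : ℕ) : ℝ) by push_cast; ring, Real.rpow_natCast,
    ← Real.rpow_two]

theorem integral_coord_pow_mul_exp {d : ℕ} (i : Fin d) (n : ℕ) :
    ∫ y : Fin d → ℂ, ‖y i‖ ^ (2 * n) * Real.exp (-‖(WithLp.toLp 2 y : Cn d)‖ ^ 2) =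
      Real.pi ^ d * n.factorial := by
  have h : ∀ y : Fin d → ℂ, ‖y i‖ ^ (2 * n) * Real.exp (-‖(WithLp.toLp 2 y : Cn d)‖ ^ 2) =
      ∏ j, ‖y j‖ ^ (2 * if j = i then n else 0) * Real.exp (-‖y j‖ ^ 2) := fun y => by
    rw [Finset.prod_mul_distrib, ← Real.exp_sum, EuclideanSpace.norm_sq_eq, Finset.sum_neg_distrib]
    congr 1
    rw [Finset.prod_eq_single i]
    · simp
    · intro j _ hj
      simp [hj]
    · simp
  simp_rw [h]
  rw [volume_pi, integral_fintype_prod_eq_prod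
    (f := fun j (z : ℂ) => ‖z‖ ^ (2 * if j = i then n else 0) * Real.exp (-‖z‖ ^ 2))]
  simp_rw [integral_norm_pow_mul_exp]
  rw [Finset.prod_mul_distrib, Finset.prod_const, Finset.card_univ, Fintype.card_fin]
  congr 1
  rw [Finset.prod_eq_single i]
  · simp
  · intro j _ hj
    simp [hj]
  · simp

/-- Completing ζ to an orthonormal basis turns pairing with ζ into a coordinate. -/
theorem exists_isometry_coord {d : ℕ} (ζ : Sph d) : ∃ (i : Fin d) (e : Cn d ≃ₗᵢ[ℝ] Cn d),
    ∀ x, inner ℂ (ζ : Cn d) x = e x i := by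
  have hd : 0 < d := by
    rcases Nat.eq_zero_or_pos d with rfl | h
    · exact absurd (Subsingleton.elim (ζ : Cn 0) 0) (ne_zero_of_mem_unit_sphere ζ)
    · exact h
  have hv : Orthonormal ℂ (({⟨0, hd⟩} : Set (Fin d)).domRestrict fun _ => (ζ : Cn d)) := by
    have hs : Subsingleton ({⟨0, hd⟩} : Set (Fin d)) := 
      ⟨fun i j => Subtype.ext ((Set.mem_singleton_iff.1 i.2).trans (Set.mem_singleton_iff.1 j.2).symm)⟩
    refine ⟨fun _ => norm_eq_of_mem_sphere ζ, fun i j hij => absurd (Subsingleton.elim i j) hij⟩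
  obtain ⟨b, hb⟩ := hv.exists_orthonormalBasis_extension_of_card_eq (by simp)
  refine ⟨⟨0, hd⟩, ⟨b.repr.toLinearEquiv.restrictScalars ℝ, b.repr.norm_map⟩, fun x => ?_⟩
  rw [← hb ⟨0, hd⟩ rfl]
  exact (b.repr_apply_apply x _).symm

theorem integral_inner_pow_mul_exp {d : ℕ} : ∃ C : ℝ, 0 < C ∧ ∀ (ζ : Sph d) (n : ℕ),
    ∫ x : Cn d, ‖inner ℂ (ζ : Cn d) x‖ ^ (2 * n) * Real.exp (-‖x‖ ^ 2) = C * n.factorial := by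
  obtain ⟨c, hc, hF⟩ := integral_eq_const_mul_integral_pi d
  refine ⟨c * Real.pi ^ d, by positivity, fun ζ n => ?_⟩
  obtain ⟨i, e, he⟩ := exists_isometry_coord ζ
  have h1 : ∫ x : Cn d, ‖inner ℂ (ζ : Cn d) x‖ ^ (2 * n) * Real.exp (-‖x‖ ^ 2) =
      ∫ x : Cn d, ‖x i‖ ^ (2 * n) * Real.exp (-‖x‖ ^ 2) := by
    refine Eq.trans ?_ (e.measurePreserving.integral_comp e.toHomeomorph.measurableEmbedding
      fun x => ‖x i‖ ^ (2 * n) * Real.exp (-‖x‖ ^ 2))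
    refine integral_congr_ae (.of_forall fun x => ?_)
    simp only [he, e.norm_map]
  rw [h1, hF, mul_assoc, ← integral_coord_pow_mul_exp i n]

variable {d : ℕ}

theorem nontrivial_Cn (hd : 1 ≤ d) : Nontrivial (Cn d) := by
  have : Nonempty (Fin d) := ⟨⟨0, hd⟩⟩
  infer_instance

theorem isProbabilityMeasure_sphereMeasure (hd : 1 ≤ d) :
    IsProbabilityMeasure (sphereMeasure d) := by
  have := nontrivial_Cn hd
  constructor
  rw [sphereMeasure, Measure.smul_apply, smul_eq_mul]
  refine ENNReal.inv_mul_cancel ?_ (measure_ne_top _ _)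
  rw [Ne, Measure.measure_univ_eq_zero]
  exact Measure.toSphere_ne_zero _

/-- The Gaussian moment C · n! equals, in polar coordinates, the spherical moment times the radial
factor (n + d - 1)!/2; dividing by the case n = 0 removes C and the area of the sphere. -/
theorem integral_sphere_inner_pow (hd : 1 ≤ d) (ζ : Sph d) (n : ℕ) :
    ∫ ξ : Sph d, ‖inner ℂ (ζ : Cn d) (ξ : Cn d)‖ ^ (2 * n) ∂sphereMeasure d =
      ((n + (d - 1)).choose (d - 1) : ℝ)⁻¹ := by
  have := nontrivial_Cn hd
  have hprob := isProbabilityMeasure_sphereMeasure hd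
  obtain ⟨C, hC, hI⟩ := integral_inner_pow_mul_exp (d := d)
  have hfr : Module.finrank ℝ (Cn d) = 2 * d := by
    rw [← Module.finrank_mul_finrank ℝ ℂ (Cn d)]
    simp
  have hT : ∀ n : ℕ, C * n.factorial =
      (∫ ξ : Sph d, ‖inner ℂ (ζ : Cn d) (ξ : Cn d)‖ ^ (2 * n) ∂(volume : Measure (Cn d)).toSphere) *
        ((n + (d - 1)).factorial / 2) := fun n => by
    rw [← hI ζ n, integral_eq_toSphere_mul volume
      (g := fun ξ => ‖inner ℂ (ζ : Cn d) (ξ : Cn d)‖ ^ (2 * n))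
      (φ := fun r => r ^ (2 * n) * Real.exp (-r ^ 2))]
    · congr 1
      have h := integral_rpow_mul_exp_neg_rpow (p := 2) (q := ((2 * (n + (d - 1)) + 1 : ℕ) : ℝ))
        (by norm_num) (by
          have : (0 : ℝ) ≤ ((2 * (n + (d - 1)) + 1 : ℕ) : ℝ) := Nat.cast_nonneg _
          linarith)
      -- The radial exponent is (2d - 1) + 2n, from the Jacobian and the moment.
      have e1 : (((2 * (n + (d - 1)) + 1 : ℕ) : ℝ) + 1) / 2 = ((n + (d - 1) : ℕ) : ℝ) + 1 := by
        push_cast; ring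
      rw [e1, Real.Gamma_nat_eq_factorial] at h
      rw [show ((n + (d - 1)).factorial : ℝ) / 2 = 1 / 2 * (n + (d - 1)).factorial by ring, ← h]
      refine setIntegral_congr_fun measurableSet_Ioi fun r _ => ?_
      rw [Real.rpow_natCast, Real.rpow_two, hfr, ← mul_assoc, ← pow_add]
      congr 2
      omega
    · intro s r hr
      have hs : ‖(s : Cn d)‖ = 1 := norm_eq_of_mem_sphere s
      rw [← Complex.coe_smul, inner_smul_right, norm_mul, norm_smul, Complex.norm_real,
        Real.norm_of_nonneg hr.le, hs, mul_one, mul_pow]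
      ring
  have hT0 : C = (volume : Measure (Cn d)).toSphere.real Set.univ * ((d - 1).factorial / 2) := by
    simpa using hT 0
  have hTn := hT n
  rw [sphereMeasure, integral_smul_measure, ENNReal.toReal_inv, smul_eq_mul]
  change ((volume : Measure (Cn d)).toSphere.real Set.univ)⁻¹ * _ = _
  set V := (volume : Measure (Cn d)).toSphere.real Set.univ with hV
  set J := ∫ ξ : Sph d, ‖inner ℂ (ζ : Cn d) (ξ : Cn d)‖ ^ (2 * n)
    ∂(volume : Measure (Cn d)).toSphere with hJ
  have hV0 : V ≠ 0 := by
    rintro h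
    rw [h, zero_mul] at hT0
    exact hC.ne' hT0
  have h3 : (((n + (d - 1)).choose (d - 1) : ℕ) : ℝ) * n.factorial * (d - 1).factorial =
      (n + (d - 1)).factorial := by
    have := Nat.add_choose_mul_factorial_mul_factorial n (d - 1)
    rw [← this]
    push_cast
    rfl
  have hf1 : ((d - 1).factorial : ℝ) ≠ 0 := by positivity
  have hf2 : (n.factorial : ℝ) ≠ 0 := by positivity
  have hf3 : (((n + (d - 1)).choose (d - 1) : ℕ) : ℝ) ≠ 0 := by
    exact_mod_cast (Nat.choose_pos (Nat.le_add_left _ _)).ne'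
  rw [hT0, ← h3] at hTn
  rw [inv_mul_eq_iff_eq_mul₀ hV0, eq_mul_inv_iff_mul_eq₀ hf3]
  have : (J * ((n + (d - 1)).choose (d - 1) : ℕ)) * (n.factorial * (d - 1).factorial) =
      V * (n.factorial * (d - 1).factorial) := by linarith
  exact mul_right_cancel₀ (mul_ne_zero hf2 hf1) this

end Sphere

/-! ### Rotation invariance and the normalization of the invariant Poisson kernel. -/

section Rotation

variable {d : ℕ}

/-- Rotation of the sphere by a complex number of modulus one. -/
noncomputable def rot (c : Circle) (ξ : Sph d) : Sph d :=
  ⟨(c : ℂ) • (ξ : Cn d), by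
    rw [mem_sphere_zero_iff_norm, norm_smul, Circle.norm_coe, one_mul]
    exact norm_eq_of_mem_sphere ξ⟩

@[simp]
theorem coe_rot (c : Circle) (ξ : Sph d) : (rot c ξ : Cn d) = (c : ℂ) • (ξ : Cn d) := rfl

theorem rot_mul (c c' : Circle) (ξ : Sph d) : rot (c * c') ξ = rot c (rot c' ξ) :=
  Subtype.ext (by simp [mul_smul])

@[simp]
theorem rot_one (ξ : Sph d) : rot 1 ξ = ξ := Subtype.ext (by simp)

theorem continuous_rot_prod : Continuous fun p : Circle × Sph d => rot p.1 p.2 :=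
  Continuous.subtype_mk ((continuous_subtype_val.comp continuous_fst).smul
    (continuous_subtype_val.comp continuous_snd)) _

theorem continuous_rot (c : Circle) : Continuous (rot c : Sph d → Sph d) :=
  continuous_rot_prod.comp (Continuous.prodMk_right c)

/-- Multiplication by a complex number of modulus one as a real linear isometry. -/
noncomputable def circleIsometry (c : Circle) : Cn d ≃ₗᵢ[ℝ] Cn d where
  toFun x := (c : ℂ) • x
  invFun x := ((c⁻¹ : Circle) : ℂ) • x
  map_add' x y := smul_add _ x y
  map_smul' r x := smul_comm _ _ _
  left_inv x := by simp [smul_smul]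
  right_inv x := by simp [smul_smul]
  norm_map' x := by
    change ‖(c : ℂ) • x‖ = ‖x‖
    rw [norm_smul, Circle.norm_coe, one_mul]

theorem circleIsometry_apply (c : Circle) (x : Cn d) : circleIsometry c x = (c : ℂ) • x := rfl

-- The spherical measure of a set is a multiple of the volume of the cone over it, and rotation acts
-- on cones by a linear isometry.
open scoped Pointwise in
theorem measurePreserving_rot (c : Circle) :
    MeasurePreserving (rot c : Sph d → Sph d) (sphereMeasure d) (sphereMeasure d) := by
  refine ⟨(continuous_rot c).measurable, ?_⟩
  rw [sphereMeasure, Measure.map_smul]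
  congr 1
  ext s hs
  have hm := (continuous_rot c).measurable hs
  rw [Measure.map_apply (continuous_rot c).measurable hs, Measure.toSphere_apply' _ hm,
    Measure.toSphere_apply' _ hs]
  congr 1
  have hpre : Set.Ioo (0 : ℝ) 1 • (Subtype.val '' ((rot c : Sph d → Sph d) ⁻¹' s)) =
      circleIsometry c ⁻¹' (Set.Ioo (0 : ℝ) 1 • (Subtype.val '' s)) := by
    ext x
    simp only [Set.mem_smul, Set.mem_image, Set.mem_preimage]
    constructor
    · rintro ⟨r, hr, _, ⟨ξ, hξ, rfl⟩, rfl⟩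
      exact ⟨r, hr, _, ⟨_, hξ, rfl⟩, (map_smul (circleIsometry c) r (ξ : Cn d)).symm⟩
    · rintro ⟨r, hr, _, ⟨ξ, hξ, rfl⟩, hx⟩
      refine ⟨r, hr, _, ⟨rot c⁻¹ ξ, ?_, rfl⟩, ?_⟩
      · rwa [← rot_mul, mul_inv_cancel, rot_one]
      · refine (circleIsometry c).injective ?_
        rw [← hx, map_smul]
        congr 1
        rw [circleIsometry_apply, coe_rot, smul_smul, ← Circle.coe_mul, mul_inv_cancel,
          Circle.coe_one, one_smul]
  rw [hpre]
  exact (circleIsometry c).measurePreserving.measure_preimage_emb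
    (circleIsometry c).toHomeomorph.measurableEmbedding _

theorem integral_rot {E : Type*} [NormedAddCommGroup E] [NormedSpace ℝ E] (c : Circle)
    {f : Sph d → E} (hf : Continuous f) :
    ∫ ξ, f (rot c ξ) ∂sphereMeasure d = ∫ ξ, f ξ ∂sphereMeasure d := by
  conv_rhs => rw [← (measurePreserving_rot c).map_eq]
  rw [integral_map (continuous_rot c).aemeasurable hf.aestronglyMeasurable]

theorem continuous_inner_sphere (ζ : Sph d) :
    Continuous fun ξ : Sph d => inner ℂ (ζ : Cn d) (ξ : Cn d) :=
  continuous_const.inner continuous_subtype_val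

theorem norm_inner_sphere_le (ζ ξ : Sph d) : ‖inner ℂ (ζ : Cn d) (ξ : Cn d)‖ ≤ 1 := by
  refine (norm_inner_le_norm _ _).trans_eq ?_
  rw [norm_eq_of_mem_sphere, norm_eq_of_mem_sphere, one_mul]

theorem integral_inner_pow_mul_conj_pow (ζ : Sph d) {m n : ℕ} (hmn : m ≠ n) :
    ∫ ξ : Sph d, inner ℂ (ζ : Cn d) (ξ : Cn d) ^ m *
      (starRingEnd ℂ) (inner ℂ (ζ : Cn d) (ξ : Cn d) ^ n) ∂sphereMeasure d = 0 := by
  have ha := continuous_inner_sphere ζ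
  have hmn' : ((m : ℝ) - n) ≠ 0 := sub_ne_zero.2 (by exact_mod_cast hmn)
  -- With this angle the rotation multiplies the integrand by exp(i(m - n)t) = -1, so the integral
  -- equals its own negative.
  set t : ℝ := Real.pi / (m - n) with ht
  have hf : Continuous fun ξ : Sph d => inner ℂ (ζ : Cn d) (ξ : Cn d) ^ m *
      (starRingEnd ℂ) (inner ℂ (ζ : Cn d) (ξ : Cn d) ^ n) :=
    (ha.pow m).mul (Complex.continuous_conj.comp (ha.pow n))
  have h := integral_rot (Circle.exp t) hf
  have hc : (Circle.exp t : ℂ) ^ m * (starRingEnd ℂ) ((Circle.exp t : ℂ) ^ n) = -1 := by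
    rw [Circle.coe_exp, ← Complex.exp_nat_mul, ← Complex.exp_nat_mul, ← Complex.exp_conj,
      ← Complex.exp_add, ← Complex.exp_pi_mul_I]
    congr 1
    have : t * (m - n) = Real.pi := div_mul_cancel₀ _ hmn'
    rw [← this]
    simp
    ring
  have h2 : ∀ ξ : Sph d, inner ℂ (ζ : Cn d) (rot (Circle.exp t) ξ : Cn d) ^ m *
      (starRingEnd ℂ) (inner ℂ (ζ : Cn d) (rot (Circle.exp t) ξ : Cn d) ^ n) =
      -1 * (inner ℂ (ζ : Cn d) (ξ : Cn d) ^ m *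
      (starRingEnd ℂ) (inner ℂ (ζ : Cn d) (ξ : Cn d) ^ n)) := fun ξ => by
    rw [← hc, coe_rot, inner_smul_right, mul_pow, mul_pow, map_mul]
    ring
  simp_rw [h2] at h
  rw [integral_const_mul] at h
  have h3 := self_eq_neg.1 (h.symm.trans (neg_one_mul _))
  exact h3

/-- The binomial series of (1 - ra)^(-d) converges uniformly because |ra| ≤ r < 1, so it may be
integrated term by term. -/
theorem hasSum_integral_geometric (hd : 1 ≤ d) (ζ : Sph d) {r : ℝ} (hr0 : 0 ≤ r) (hr1 : r < 1)
    {G : Sph d → ℂ} (hG : Continuous G) :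
    HasSum (fun n : ℕ => ((n + (d - 1)).choose (d - 1) : ℂ) * r ^ n *
        ∫ ξ : Sph d, inner ℂ (ζ : Cn d) (ξ : Cn d) ^ n * G ξ ∂sphereMeasure d)
      (∫ ξ : Sph d, 1 / (1 - r * inner ℂ (ζ : Cn d) (ξ : Cn d)) ^ d * G ξ ∂sphereMeasure d) := by
  have := isProbabilityMeasure_sphereMeasure hd
  obtain ⟨C, hC⟩ := (isCompact_range hG).isBounded.exists_norm_le
  have ha := continuous_inner_sphere ζ
  have hsum : Summable fun n : ℕ => ((n + (d - 1)).choose (d - 1) : ℝ) * r ^ n :=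
    (hasSum_choose_mul_geometric_of_norm_lt_one (d - 1)
      (by rwa [Real.norm_of_nonneg hr0])).summable
  have hcont : ∀ n : ℕ, Continuous fun ξ : Sph d => ((n + (d - 1)).choose (d - 1) : ℂ) * r ^ n *
      (inner ℂ (ζ : Cn d) (ξ : Cn d) ^ n * G ξ) := fun n =>
    continuous_const.mul ((ha.pow n).mul hG)
  have key := hasSum_integral_of_dominated_convergence (μ := sphereMeasure d)
    (F := fun (n : ℕ) (ξ : Sph d) => ((n + (d - 1)).choose (d - 1) : ℂ) * r ^ n *
      (inner ℂ (ζ : Cn d) (ξ : Cn d) ^ n * G ξ))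
    (f := fun ξ => 1 / (1 - r * inner ℂ (ζ : Cn d) (ξ : Cn d)) ^ d * G ξ)
    (bound := fun n _ => ((n + (d - 1)).choose (d - 1) : ℝ) * r ^ n * C)
    (fun n => (hcont n).aestronglyMeasurable)
    (fun n => .of_forall fun ξ => ?_) (.of_forall fun _ => hsum.mul_right C)
    (integrable_const _) (.of_forall fun ξ => ?_)
  · simpa only [integral_const_mul] using key
  · rw [norm_mul, norm_mul, norm_mul, norm_pow, norm_pow, Complex.norm_real,
      Real.norm_of_nonneg hr0, Complex.norm_natCast]
    have h1 : ‖inner ℂ (ζ : Cn d) (ξ : Cn d)‖ ^ n ≤ 1 :=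
      pow_le_one₀ (norm_nonneg _) (norm_inner_sphere_le ζ ξ)
    have h2 : ‖inner ℂ (ζ : Cn d) (ξ : Cn d)‖ ^ n * ‖G ξ‖ ≤ C :=
      (mul_le_of_le_one_left (norm_nonneg _) h1).trans (hC _ (Set.mem_range_self ξ))
    exact mul_le_mul_of_nonneg_left h2 (by positivity)
  · have hw : ‖(r : ℂ) * inner ℂ (ζ : Cn d) (ξ : Cn d)‖ < 1 := by
      rw [norm_mul, Complex.norm_real, Real.norm_of_nonneg hr0]
      exact (mul_le_of_le_one_right hr0 (norm_inner_sphere_le ζ ξ)).trans_lt hr1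
    have h := (hasSum_choose_mul_geometric_of_norm_lt_one (d - 1) hw).mul_right (G ξ)
    rw [Nat.sub_add_cancel hd] at h
    convert! h using 2 with n
    rw [mul_pow]
    ring

/-- With a = ⟨ξ, ζ⟩ the kernel is (1 - r²)^d |S|², where S = (1 - ra)^(-d). Expanding S and using
orthogonality of the powers of a, the moments cancel one of the two binomial coefficients in each
term, so ∫|S|² is the binomial series of (1 - r²)^(-d). -/
theorem integral_poissonKernel (hd : 1 ≤ d) (ζ : Sph d) {r : ℝ} (hr0 : 0 ≤ r) (hr1 : r < 1) :
    ∫ ξ : Sph d, poissonKernel ((r : ℂ) • (ξ : Cn d)) (ζ : Cn d) ∂sphereMeasure d = 1 := by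
  have := isProbabilityMeasure_sphereMeasure hd
  have ha := continuous_inner_sphere ζ
  set a : Sph d → ℂ := fun ξ => inner ℂ (ζ : Cn d) (ξ : Cn d) with hadef
  set c : ℕ → ℕ := fun n => (n + (d - 1)).choose (d - 1) with hc
  have hr2 : r ^ 2 < 1 := by nlinarith
  have hden : ∀ ξ, 1 - (r : ℂ) * a ξ ≠ 0 := fun ξ h => by
    have h1 : ‖(r : ℂ) * a ξ‖ < 1 := by
      rw [norm_mul, Complex.norm_real, Real.norm_of_nonneg hr0]
      exact (mul_le_of_le_one_right hr0 (norm_inner_sphere_le ζ ξ)).trans_lt hr1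
    rw [← sub_eq_zero.1 h, norm_one] at h1
    exact lt_irrefl _ h1
  set S : Sph d → ℂ := fun ξ => 1 / (1 - r * a ξ) ^ d with hS
  have hScont : Continuous S :=
    continuous_const.div ((continuous_const.sub (continuous_const.mul ha)).pow d)
      fun ξ => pow_ne_zero _ (hden ξ)
  have hJ : ∀ n, ∫ ξ, a ξ ^ n * (starRingEnd ℂ) (a ξ ^ n) ∂sphereMeasure d = ((c n : ℝ)⁻¹ : ℝ) := by
    intro n
    rw [← integral_sphere_inner_pow hd ζ n, ← integral_complex_ofReal]
    refine integral_congr_ae (.of_forall fun ξ => ?_)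
    simp only
    rw [Complex.mul_conj, Complex.normSq_eq_norm_sq, norm_pow, ← pow_mul, mul_comm n 2]
  have hc0 : ∀ n, (c n : ℝ) ≠ 0 := fun n => by
    exact_mod_cast (Nat.choose_pos (Nat.le_add_left _ _)).ne'
  have h1 : ∀ n, ∫ ξ, a ξ ^ n * (starRingEnd ℂ) (S ξ) ∂sphereMeasure d = (r : ℂ) ^ n := by
    intro n
    have h := hasSum_integral_geometric hd ζ hr0 hr1
      (G := fun ξ => (starRingEnd ℂ) (a ξ ^ n)) (Complex.continuous_conj.comp (ha.pow n))
    -- Only the term of index n survives, by orthogonality.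
    have h' := (hasSum_single n fun m hm => by
      rw [integral_inner_pow_mul_conj_pow ζ hm, mul_zero]).unique h
    have h2 : ∫ ξ, a ξ ^ n * (starRingEnd ℂ) (S ξ) ∂sphereMeasure d =
        (starRingEnd ℂ) (∫ ξ, S ξ * (starRingEnd ℂ) (a ξ ^ n) ∂sphereMeasure d) := by
      rw [← integral_conj]
      refine integral_congr_ae (.of_forall fun ξ => ?_)
      simp [mul_comm]
    rw [h2]
    have h3 : ∫ ξ, S ξ * (starRingEnd ℂ) (a ξ ^ n) ∂sphereMeasure d = (r : ℂ) ^ n := by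
      refine h'.symm.trans ?_
      refine (congrArg _ (hJ n)).trans ?_
      have := hc0 n
      push_cast
      rw [mul_right_comm, mul_inv_cancel₀ (by exact_mod_cast this), one_mul]
    rw [h3]
    simp
  have h2 := hasSum_integral_geometric hd ζ hr0 hr1
    (G := fun ξ => (starRingEnd ℂ) (S ξ)) (Complex.continuous_conj.comp hScont)
  have h3 : HasSum (fun n : ℕ => (c n : ℂ) * ((r ^ 2 : ℝ) : ℂ) ^ n)
      (1 / (1 - ((r ^ 2 : ℝ) : ℂ)) ^ d) := by
    have h := hasSum_choose_mul_geometric_of_norm_lt_one (d - 1) (r := ((r ^ 2 : ℝ) : ℂ))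
      (by rwa [Complex.norm_real, Real.norm_of_nonneg (sq_nonneg r)])
    rwa [Nat.sub_add_cancel hd] at h
  have h4 : ∫ ξ, S ξ * (starRingEnd ℂ) (S ξ) ∂sphereMeasure d =
      1 / (1 - ((r ^ 2 : ℝ) : ℂ)) ^ d := by
    refine h2.unique ?_
    convert! h3 using 2 with n
    refine (congrArg _ (h1 n)).trans ?_
    push_cast
    ring
  have h5 : ∀ ξ : Sph d, poissonKernel ((r : ℂ) • (ξ : Cn d)) (ζ : Cn d) =
      (1 - r ^ 2) ^ d * ‖S ξ‖ ^ 2 := fun ξ => by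
    rw [poissonKernel, inner_smul_right, norm_smul, norm_eq_of_mem_sphere, Complex.norm_real,
      Real.norm_of_nonneg hr0, mul_one, hS]
    simp only
    rw [norm_div, norm_one, norm_pow, div_pow, div_pow, one_pow, ← pow_mul, ← pow_mul, mul_comm d 2,
      mul_one_div]
  simp_rw [h5]
  rw [integral_const_mul]
  have h6 : ((∫ ξ, ‖S ξ‖ ^ 2 ∂sphereMeasure d : ℝ) : ℂ) = ((1 / (1 - r ^ 2) ^ d : ℝ) : ℂ) := by
    rw [← integral_complex_ofReal]
    push_cast at h4 ⊢
    rw [← h4]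
    refine integral_congr_ae (.of_forall fun ξ => ?_)
    simp only
    rw [Complex.mul_conj, Complex.normSq_eq_norm_sq]
    push_cast
    rfl
  rw [Complex.ofReal_inj.1 h6]
  exact mul_one_div_cancel (pow_ne_zero _ (by linarith))

end Rotation

/-! ### The uniform measure on the circle and the Poisson formula on the disk. -/

section Circle

noncomputable instance instMeasurableSpaceCircle : MeasurableSpace Circle := borel Circle

instance instBorelSpaceCircle : BorelSpace Circle := ⟨rfl⟩

/-- The uniform probability measure on the unit circle. -/
noncomputable def circleMeasure : Measure Circle :=
  ((ENNReal.ofReal (2 * Real.pi))⁻¹ • volume.restrict (Set.Ioc 0 (2 * Real.pi))).map Circle.exp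

theorem continuous_circle_coe : Continuous fun c : Circle => (c : ℂ) := continuous_subtype_val

theorem ofReal_two_pi_ne_zero : ENNReal.ofReal (2 * Real.pi) ≠ 0 := by
  simpa using Real.pi_pos

instance isProbabilityMeasure_circleMeasure : IsProbabilityMeasure circleMeasure := by
  constructor
  rw [circleMeasure, Measure.map_apply Circle.exp.continuous.measurable MeasurableSet.univ,
    Set.preimage_univ, Measure.smul_apply, Measure.restrict_apply_univ, Real.volume_Ioc, sub_zero,
    smul_eq_mul]
  exact ENNReal.inv_mul_cancel ofReal_two_pi_ne_zero ENNReal.ofReal_ne_top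

variable {E : Type*} [NormedAddCommGroup E] [NormedSpace ℝ E]

theorem integral_circleMeasure [SecondCountableTopology E] {f : Circle → E} (hf : Continuous f) :
    ∫ c, f c ∂circleMeasure =
      (2 * Real.pi)⁻¹ • ∫ θ in (0 : ℝ)..(2 * Real.pi), f (Circle.exp θ) := by
  borelize E
  rw [circleMeasure, integral_map Circle.exp.continuous.aemeasurable
    hf.measurable.aestronglyMeasurable, integral_smul_measure,
    intervalIntegral.integral_of_le Real.two_pi_pos.le, ENNReal.toReal_inv,
    ENNReal.toReal_ofReal Real.two_pi_pos.le]

theorem integral_circleMeasure_mul_right [SecondCountableTopology E] {f : Circle → E}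
    (hf : Continuous f) (a : Circle) :
    ∫ c, f (c * a) ∂circleMeasure = ∫ c, f c ∂circleMeasure := by
  obtain ⟨α, rfl⟩ := Circle.exp_surjective a
  rw [integral_circleMeasure hf, integral_circleMeasure (f := fun c => f (c * Circle.exp α))
    (hf.comp (continuous_mul_const _))]
  congr 1
  simp_rw [← Circle.exp_add]
  rw [intervalIntegral.integral_comp_add_right fun θ => f (Circle.exp θ)]
  have hper : Function.Periodic (fun θ => f (Circle.exp θ)) (2 * Real.pi) := fun θ =>
    congrArg f (Circle.periodic_exp θ)
  have h := hper.intervalIntegral_add_eq α 0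
  rw [zero_add] at h ⊢
  rwa [add_comm (2 * Real.pi)]

theorem integral_circleMeasure_eq_circleAverage [SecondCountableTopology E] {f : ℂ → E} {r : ℝ}
    (hf : Continuous fun c : Circle => f (r * c)) :
    ∫ c : Circle, f (r * c) ∂circleMeasure = Real.circleAverage f 0 r := by
  rw [integral_circleMeasure hf, Real.circleAverage]
  simp [circleMap]

/-- This is the Poisson formula on the closed disk of radius r < 1, rescaled to the unit circle; it
is applied to the real and imaginary parts separately. -/
theorem integral_poisson_disc {v : ℂ → ℂ} (hv : InnerProductSpace.HarmonicOnNhd v (ball 0 1))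
    {r : ℝ} (hr0 : 0 < r) (hr1 : r < 1) {z : ℂ} (hz : ‖z‖ < 1) :
    ∫ c : Circle, (((1 - ‖z‖ ^ 2) / ‖(c : ℂ) - z‖ ^ 2 : ℝ) : ℂ) * v (r * c) ∂circleMeasure =
      v (r * z) := by
  have hden : ∀ c : Circle, ‖(c : ℂ) - z‖ ^ 2 ≠ 0 := fun c h => by
    have h1 : (c : ℂ) = z := by simpa [sub_eq_zero] using h
    rw [← h1, Circle.norm_coe] at hz
    exact lt_irrefl _ hz
  have hw : (r : ℂ) * z ∈ ball (0 : ℂ) r := by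
    rw [mem_ball_zero_iff, norm_mul, Complex.norm_real, Real.norm_of_nonneg hr0.le]
    exact mul_lt_of_lt_one_right hr0 hz
  have hvc : Continuous fun c : Circle => v (r * c) := by
    refine hv.continuousOn.comp_continuous (continuous_const.mul continuous_circle_coe) fun c => ?_
    rw [mem_ball_zero_iff, norm_mul, Complex.norm_real, Real.norm_of_nonneg hr0.le, Circle.norm_coe,
      mul_one]
    exact hr1
  have hPc : Continuous fun c : Circle => ((1 - ‖z‖ ^ 2) / ‖(c : ℂ) - z‖ ^ 2 : ℝ) :=
    continuous_const.div ((continuous_circle_coe.sub continuous_const).norm.pow 2) hden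
  have hker : ∀ c : Circle, _root_.poissonKernel 0 (r * z) (r * c) =
      (1 - ‖z‖ ^ 2) / ‖(c : ℂ) - z‖ ^ 2 := fun c => by
    rw [poissonKernel_def, sub_zero, sub_zero, ← mul_sub, norm_mul, norm_mul, norm_mul,
      Complex.norm_real, Real.norm_of_nonneg hr0.le, Circle.norm_coe, mul_one, mul_pow, mul_pow,
      ← mul_one_sub, mul_div_mul_left _ _ (by positivity)]
  have hreal : ∀ l : ℂ →L[ℝ] ℝ, ∫ c : Circle, (1 - ‖z‖ ^ 2) / ‖(c : ℂ) - z‖ ^ 2 * l (v (r * c))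
      ∂circleMeasure = l (v (r * z)) := fun l => by
    have h := InnerProductSpace.HarmonicOnNhd.circleAverage_poissonKernel_smul
      ((hv.mono (closedBall_subset_ball hr1)).comp_CLM l) hw
    have h2 : ∀ c : Circle, (_root_.poissonKernel 0 (r * z) • (l ∘ v)) (r * c) =
        (1 - ‖z‖ ^ 2) / ‖(c : ℂ) - z‖ ^ 2 * l (v (r * c)) := fun c => by
      rw [Pi.smul_apply', hker, smul_eq_mul]
      rfl
    rw [← integral_circleMeasure_eq_circleAverage] at h
    · simp_rw [h2] at h
      exact h
    · simp_rw [h2]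
      exact hPc.mul (l.continuous.comp hvc)
  have hi : Integrable (fun c : Circle => (((1 - ‖z‖ ^ 2) / ‖(c : ℂ) - z‖ ^ 2 : ℝ) : ℂ) *
      v (r * c)) circleMeasure :=
    integrable_of_continuous _ ((Complex.continuous_ofReal.comp hPc).mul hvc)
  refine Complex.ext ?_ ?_
  · refine (Complex.reCLM.integral_comp_comm hi).symm.trans (Eq.trans ?_ (hreal Complex.reCLM))
    refine integral_congr_ae (.of_forall fun c => ?_)
    exact Complex.re_ofReal_mul _ _
  · refine (Complex.imCLM.integral_comp_comm hi).symm.trans (Eq.trans ?_ (hreal Complex.imCLM))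
    refine integral_congr_ae (.of_forall fun c => ?_)
    exact Complex.im_ofReal_mul _ _

theorem integral_poisson_disc_one {z : ℂ} (hz : ‖z‖ < 1) :
    ∫ c : Circle, (1 - ‖z‖ ^ 2) / ‖(c : ℂ) - z‖ ^ 2 ∂circleMeasure = 1 := by
  have h := integral_poisson_disc (v := fun _ => 1)
    (InnerProductSpace.harmonicOnNhd_const 1) (r := 1 / 2) (by norm_num) (by norm_num) hz
  simp only [mul_one] at h
  rw [integral_complex_ofReal] at h
  exact_mod_cast h

end Circle

/-! ### The circles over projective space and the disintegration of σ. -/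

section Fiber

variable {d : ℕ}

theorem proj_eq_proj_iff {ξ ξ' : Sph d} : proj ξ' = proj ξ ↔ ∃ c : Circle, ξ' = rot c ξ := by
  rw [proj, proj, Projectivization.mk_eq_mk_iff']
  constructor
  · rintro ⟨a, ha⟩
    have hn : ‖a‖ = 1 := by
      have h := congrArg norm ha
      rwa [norm_smul, norm_eq_of_mem_sphere, norm_eq_of_mem_sphere, mul_one] at h
    exact ⟨⟨a, mem_sphere_zero_iff_norm.2 hn⟩, Subtype.ext ha.symm⟩
  · rintro ⟨c, rfl⟩
    exact ⟨c, rfl⟩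

theorem proj_rot (c : Circle) (ξ : Sph d) : proj (rot c ξ) = proj ξ :=
  proj_eq_proj_iff.2 ⟨c, rfl⟩

theorem proj_surjective : Function.Surjective (proj (d := d)) := by
  intro ζ
  induction ζ using Projectivization.ind with
  | h v hv =>
    have hn : ‖v‖ ≠ 0 := norm_ne_zero_iff.2 hv
    refine ⟨⟨((‖v‖⁻¹ : ℝ) : ℂ) • v, ?_⟩, ?_⟩
    · rw [mem_sphere_zero_iff_norm, norm_smul, Complex.norm_real, norm_inv, norm_norm,
        inv_mul_cancel₀ hn]
    · rw [proj, Projectivization.mk_eq_mk_iff']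
      exact ⟨_, rfl⟩

theorem isClosed_fiber (ζ : Proj d) : IsClosed (proj ⁻¹' {ζ} : Set (Sph d)) := by
  obtain ⟨ξ, rfl⟩ := proj_surjective ζ
  have h : (proj ⁻¹' {proj ξ} : Set (Sph d)) = Set.range fun c : Circle => rot c ξ := by
    ext ξ'
    simp only [Set.mem_preimage, Set.mem_singleton_iff, Set.mem_range]
    rw [proj_eq_proj_iff]
    exact exists_congr fun c => eq_comm
  rw [h]
  exact (isCompact_range (continuous_rot_prod.comp (Continuous.prodMk_left ξ))).isClosed

/-- Radial normalization of nonzero vectors factors the quotient map continuously through the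
sphere. -/
theorem continuous_of_comp_proj {Y : Type*} [TopologicalSpace Y] {f : Proj d → Y}
    (hf : Continuous fun ξ : Sph d => f (proj ξ)) : Continuous f := by
  have hq : IsQuotientMap (Quotient.mk (projectivizationSetoid ℂ (Cn d))) := isQuotientMap_quot_mk
  refine hq.continuous_iff.2 ?_
  let ρ : {v : Cn d // v ≠ 0} → Sph d := fun v => ⟨((‖(v : Cn d)‖⁻¹ : ℝ) : ℂ) • (v : Cn d), by
    rw [mem_sphere_zero_iff_norm, norm_smul, Complex.norm_real, norm_inv, norm_norm,
        inv_mul_cancel₀ (norm_ne_zero_iff.2 v.2)]⟩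
  have hρ : Continuous ρ :=
    Continuous.subtype_mk ((Complex.continuous_ofReal.comp (continuous_subtype_val.norm.inv₀
      fun v => norm_ne_zero_iff.2 v.2)).smul continuous_subtype_val) _
  refine (hf.comp hρ).congr fun v => ?_
  refine congrArg f ?_
  refine (Projectivization.mk_eq_mk_iff' ℂ _ _ _ v.2).2 ⟨_, rfl⟩

/-- The uniform probability measure on the circle through `ξ`. -/
noncomputable def orbitMeasure (ξ : Sph d) : Measure (Sph d) :=
  circleMeasure.map fun c => rot c ξ

theorem continuous_orbit (ξ : Sph d) : Continuous fun c : Circle => rot c ξ :=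
  continuous_rot_prod.comp (Continuous.prodMk_left ξ)

instance isProbabilityMeasure_orbitMeasure (ξ : Sph d) : IsProbabilityMeasure (orbitMeasure ξ) :=
  Measure.isProbabilityMeasure_map (continuous_orbit ξ).aemeasurable

variable {E : Type*} [NormedAddCommGroup E] [NormedSpace ℝ E] [SecondCountableTopology E]

theorem integral_orbitMeasure (ξ : Sph d) {f : Sph d → E} (hf : Continuous f) :
    ∫ w, f w ∂orbitMeasure ξ = ∫ c, f (rot c ξ) ∂circleMeasure :=
  integral_map (continuous_orbit ξ).aemeasurable hf.aestronglyMeasurable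

theorem orbitMeasure_rot (c : Circle) (ξ : Sph d) : orbitMeasure (rot c ξ) = orbitMeasure ξ := by
  refine ext_of_forall_integral_eq_of_IsFiniteMeasure fun f => ?_
  rw [integral_orbitMeasure _ f.continuous, integral_orbitMeasure _ f.continuous]
  simp_rw [← rot_mul]
  exact integral_circleMeasure_mul_right (f.continuous.comp (continuous_orbit ξ)) c

/-- The uniform probability measure on the circle over a point of projective space. -/
noncomputable def fiberMeasure (ζ : Proj d) : Measure (Sph d) :=
  orbitMeasure (Function.surjInv proj_surjective ζ)

instance isProbabilityMeasure_fiberMeasure (ζ : Proj d) : IsProbabilityMeasure (fiberMeasure ζ) :=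
  isProbabilityMeasure_orbitMeasure _

/-- Rotation invariance removes the dependence on the chosen point of the circle. -/
theorem fiberMeasure_proj (ξ : Sph d) : fiberMeasure (proj ξ) = orbitMeasure ξ := by
  obtain ⟨c, hc⟩ := proj_eq_proj_iff.1 (Function.surjInv_eq proj_surjective (proj ξ))
  rw [fiberMeasure, hc, orbitMeasure_rot]

theorem fiberMeasure_compl (ζ : Proj d) : fiberMeasure ζ (proj ⁻¹' {ζ})ᶜ = 0 := by
  obtain ⟨ξ, rfl⟩ := proj_surjective ζ
  rw [fiberMeasure_proj, orbitMeasure, Measure.map_apply (continuous_orbit ξ).measurable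
    (isClosed_fiber _).measurableSet.compl]
  convert! measure_empty (μ := circleMeasure)
  ext c
  simp [proj_rot]

theorem continuous_integral_fiberMeasure {f : Sph d → E} (hf : Continuous f) :
    Continuous fun ζ : Proj d => ∫ w, f w ∂fiberMeasure ζ := by
  refine continuous_of_comp_proj ?_
  simp_rw [fiberMeasure_proj, integral_orbitMeasure _ hf]
  have h := continuous_parametric_integral_of_continuous (μ := circleMeasure)
    (f := fun (ξ : Sph d) (c : Circle) => f (rot c ξ))
    (hf.comp (continuous_rot_prod.comp continuous_swap)) isCompact_univ
  simpa only [setIntegral_univ] using h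

theorem measurable_proj : Measurable (proj (d := d)) := continuous_proj.measurable

theorem isProbabilityMeasure_projMeasure (hd : 1 ≤ d) : IsProbabilityMeasure (projMeasure d) := by
  have := isProbabilityMeasure_sphereMeasure hd
  exact Measure.isProbabilityMeasure_map measurable_proj.aemeasurable

/-- Averaging f over rotations and exchanging the integrals leaves ∫ f dσ, as every rotation
preserves σ. -/
theorem integral_projMeasure_fiberMeasure [CompleteSpace E] (hd : 1 ≤ d) {f : Sph d → E} (hf : Continuous f) :
    ∫ ζ, ∫ w, f w ∂fiberMeasure ζ ∂projMeasure d = ∫ ξ, f ξ ∂sphereMeasure d := by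
  have := isProbabilityMeasure_sphereMeasure hd
  borelize E
  rw [projMeasure, integral_map measurable_proj.aemeasurable
    (continuous_integral_fiberMeasure hf).measurable.aestronglyMeasurable]
  simp_rw [fiberMeasure_proj, integral_orbitMeasure _ hf]
  have hi : Integrable (fun p : Sph d × Circle => f (rot p.2 p.1))
      ((sphereMeasure d).prod circleMeasure) :=
    integrable_of_continuous _ (hf.comp (continuous_rot_prod.comp continuous_swap))
  have h : ∀ c : Circle, ∫ ξ, f (rot c ξ) ∂sphereMeasure d = ∫ ξ, f ξ ∂sphereMeasure d :=
    fun c => integral_rot c hf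
  refine (integral_integral_swap hi).trans ((integral_congr_ae (.of_forall h)).trans ?_)
  simp

end Fiber

/-! ### A sequence of radii tending to one. -/

section Radius

/-- A sequence of radii in `[1/2, 1)` with limit `1`. -/
noncomputable def radius (n : ℕ) : ℝ := 1 - ((n : ℝ) + 2)⁻¹

theorem half_le_radius (n : ℕ) : 1 / 2 ≤ radius n := by
  have h : ((n : ℝ) + 2)⁻¹ ≤ 2⁻¹ := inv_anti₀ (by norm_num) (by simp)
  rw [radius]
  linarith

theorem radius_pos (n : ℕ) : 0 < radius n := lt_of_lt_of_le (by norm_num) (half_le_radius n)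

theorem radius_lt_one (n : ℕ) : radius n < 1 := by
  rw [radius, sub_lt_self_iff]
  positivity

theorem tendsto_radius : Tendsto radius atTop (𝓝 1) := by
  have h : Tendsto (fun n : ℕ => ((n : ℝ) + 2)⁻¹) atTop (𝓝 0) :=
    tendsto_inv_atTop_zero.comp (tendsto_atTop_add_const_right _ _ tendsto_natCast_atTop_atTop)
  have h1 := h.const_sub (1 : ℝ)
  rw [sub_zero] at h1
  exact h1

theorem norm_radius (n : ℕ) : ‖(radius n : ℂ)‖ = radius n := by
  rw [Complex.norm_real, Real.norm_of_nonneg (radius_pos n).le]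

theorem norm_radius_smul {d : ℕ} (n : ℕ) (ξ : Sph d) :
    ‖(radius n : ℂ) • (ξ : Cn d)‖ = radius n := by
  rw [norm_smul, norm_eq_of_mem_sphere, mul_one, norm_radius]

theorem one_sub_radius_sq_nonneg (n : ℕ) : 0 ≤ 1 - radius n ^ 2 := by
  nlinarith [radius_pos n, radius_lt_one n]

theorem tendsto_one_sub_radius_sq_div (C : ℝ) :
    Tendsto (fun n => (1 - radius n ^ 2) / C) atTop (𝓝 0) := by
  have h := ((tendsto_radius.pow 2).const_sub (1 : ℝ)).div_const C
  simpa using h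

end Radius

/-! ### The invariant and the disk Poisson kernels as approximate identities. -/

section ApproxKernels

variable {d : ℕ}

theorem one_sub_inner_radius_smul_ne_zero (n : ℕ) (ξ ζ : Sph d) :
    1 - inner ℂ (ζ : Cn d) ((radius n : ℂ) • (ξ : Cn d)) ≠ 0 := fun h => by
  have h1 : ‖inner ℂ (ζ : Cn d) ((radius n : ℂ) • (ξ : Cn d))‖ < 1 := by
    rw [inner_smul_right, norm_mul, norm_radius]
    exact (mul_le_of_le_one_right (radius_pos n).le (norm_inner_sphere_le ζ ξ)).trans_lt
      (radius_lt_one n)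
  rw [← sub_eq_zero.1 h, norm_one] at h1
  exact lt_irrefl _ h1

theorem isApproxKernel_poissonKernel (hd : 1 ≤ d) (μ : ComplexMeasure (Sph d)) :
    IsApproxKernel (sphereMeasure d) μ
      fun n ξ ζ => poissonKernel ((radius n : ℂ) • (ξ : Cn d)) (ζ : Cn d) where
  continuous n := by
    have h1 : Continuous fun p : Sph d × Sph d => (radius n : ℂ) • (p.1 : Cn d) := by fun_prop
    have h2 : Continuous fun p : Sph d × Sph d => (p.2 : Cn d) := by fun_prop
    have h3 : Continuous fun p : Sph d × Sph d =>
        (inner ℂ (p.2 : Cn d) ((radius n : ℂ) • (p.1 : Cn d)) : ℂ) := Continuous.inner h2 h1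
    have h4 : Continuous fun p : Sph d × Sph d =>
        ‖1 - inner ℂ (p.2 : Cn d) ((radius n : ℂ) • (p.1 : Cn d))‖ ^ 2 :=
      (continuous_const.sub h3).norm.pow 2
    have h5 : Continuous fun p : Sph d × Sph d =>
        1 - ‖(radius n : ℂ) • (p.1 : Cn d)‖ ^ 2 := continuous_const.sub (h1.norm.pow 2)
    simp only [poissonKernel]
    exact (h5.div h4 fun p => pow_ne_zero _
      (norm_ne_zero_iff.2 (one_sub_inner_radius_smul_ne_zero n p.1 p.2))).pow d
  nonneg n ξ ζ := by
    rw [poissonKernel, norm_radius_smul]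
    have := one_sub_radius_sq_nonneg n
    positivity
  integral_eq_one n :=
    .of_forall fun ζ => integral_poissonKernel hd ζ (radius_pos n).le (radius_lt_one n)
  concentrated δ hδ ε hε := by
    have h := (tendsto_one_sub_radius_sq_div ((δ ^ 2 / 4) ^ 2)).pow d
    rw [zero_pow (by omega)] at h
    filter_upwards [h.eventually_le_const hε] with n hn ξ ζ hξζ
    refine le_trans ?_ hn
    rw [poissonKernel, norm_radius_smul]
    have h0 := one_sub_radius_sq_nonneg n
    -- Since Re⟨ξ, ζ⟩ = 1 - |ξ - ζ|²/2, the real part of 1 - r⟨ξ, ζ⟩ is (1 - r) + r|ξ - ζ|²/2, and r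
    -- ≥ 1/2.
    have hA : δ ^ 2 / 4 ≤ ‖1 - inner ℂ (ζ : Cn d) ((radius n : ℂ) • (ξ : Cn d))‖ := by
      refine le_trans ?_ (Complex.re_le_norm _)
      rw [inner_smul_right, Complex.sub_re, Complex.re_ofReal_mul, Complex.one_re]
      have h1 := norm_sub_sq (𝕜 := ℂ) (ζ : Cn d) (ξ : Cn d)
      rw [norm_eq_of_mem_sphere, norm_eq_of_mem_sphere, ← dist_eq_norm, dist_comm] at h1
      have h2 : δ ^ 2 ≤ dist (ξ : Cn d) (ζ : Cn d) ^ 2 := pow_le_pow_left₀ hδ.le hξζ 2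
      have h3 : RCLike.re (inner ℂ (ζ : Cn d) (ξ : Cn d)) = (inner ℂ (ζ : Cn d) (ξ : Cn d)).re :=
        rfl
      rw [h3] at h1
      nlinarith [half_le_radius n, radius_lt_one n, sq_nonneg (dist (ξ : Cn d) (ζ : Cn d))]
    gcongr

theorem norm_sub_smul_rot (z : ℂ) (c : Circle) (ξ : Sph d) :
    ‖(rot c ξ : Cn d) - z • (ξ : Cn d)‖ = ‖(c : ℂ) - z‖ := by
  rw [coe_rot, ← sub_smul, norm_smul, norm_eq_of_mem_sphere, mul_one]

/-- The symmetry |1 - rc| = |c - r| for |c| = 1 lets the disk kernel be integrated over its first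
variable by the Poisson formula. -/
theorem norm_sub_radius_smul_rot (n : ℕ) (c : Circle) (ξ : Sph d) :
    ‖(ξ : Cn d) - (radius n : ℂ) • (rot c ξ : Cn d)‖ = ‖(c : ℂ) - radius n‖ := by
  have h1 : (ξ : Cn d) - (radius n : ℂ) • (rot c ξ : Cn d) =
      (1 - radius n * (c : ℂ)) • (ξ : Cn d) := by
    rw [coe_rot, sub_smul, one_smul, mul_smul]
  have h2 : (1 : ℂ) - radius n * c = c * (starRingEnd ℂ) (c - radius n) := by
    rw [map_sub, mul_sub, Complex.mul_conj, Circle.normSq_coe, Complex.conj_ofReal]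
    push_cast
    ring
  rw [h1, norm_smul, norm_eq_of_mem_sphere, mul_one, h2, norm_mul, Circle.norm_coe, one_mul,
    RCLike.norm_conj]

theorem one_sub_radius_le_norm (n : ℕ) (w v : Sph d) :
    1 - radius n ≤ ‖(v : Cn d) - (radius n : ℂ) • (w : Cn d)‖ := by
  have h := norm_sub_norm_le (v : Cn d) ((radius n : ℂ) • (w : Cn d))
  rwa [norm_radius_smul, norm_eq_of_mem_sphere] at h

theorem sub_smul_ne_zero {z : ℂ} (hz : ‖z‖ < 1) (w ξ : Sph d) :
    (w : Cn d) - z • (ξ : Cn d) ≠ 0 := fun h => by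
  have h1 := congrArg norm (sub_eq_zero.1 h)
  rw [norm_smul, norm_eq_of_mem_sphere, norm_eq_of_mem_sphere, mul_one] at h1
  exact hz.ne h1.symm

/-- The Poisson kernel of the disk through a circle of the sphere, at the points of radius
`radius n`. -/
noncomputable def diskKernel (n : ℕ) (w v : Sph d) : ℝ :=
  (1 - ‖(radius n : ℂ)‖ ^ 2) / ‖(v : Cn d) - (radius n : ℂ) • (w : Cn d)‖ ^ 2

theorem continuous_diskKernel (n : ℕ) :
    Continuous fun p : Sph d × Sph d => diskKernel n p.1 p.2 := by
  refine continuous_const.div (by fun_prop) fun p => pow_ne_zero _ (norm_ne_zero_iff.2 ?_)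
  exact sub_smul_ne_zero ((norm_radius n).trans_lt (radius_lt_one n)) _ _

theorem diskKernel_nonneg (n : ℕ) (w v : Sph d) : 0 ≤ diskKernel n w v := by
  rw [diskKernel, norm_radius]
  exact div_nonneg (one_sub_radius_sq_nonneg n) (sq_nonneg _)

theorem integral_diskKernel (n : ℕ) (v : Sph d) :
    ∫ w, diskKernel n w v ∂fiberMeasure (proj v) = 1 := by
  have h : Continuous fun w : Sph d => diskKernel n w v := by
    refine continuous_const.div (by fun_prop) fun w => pow_ne_zero _ (norm_ne_zero_iff.2 ?_)
    exact sub_smul_ne_zero ((norm_radius n).trans_lt (radius_lt_one n)) _ _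
  rw [fiberMeasure_proj, integral_orbitMeasure v h]
  simp_rw [diskKernel, norm_sub_radius_smul_rot]
  exact integral_poisson_disc_one ((norm_radius n).trans_lt (radius_lt_one n))

theorem norm_radius_smul_sub (n : ℕ) (w : Sph d) :
    ‖(radius n : ℂ) • (w : Cn d) - (w : Cn d)‖ = 1 - radius n := by
  have h1 : (radius n : ℂ) • (w : Cn d) - (w : Cn d) = ((radius n - 1 : ℝ) : ℂ) • (w : Cn d) := by
    rw [Complex.ofReal_sub, Complex.ofReal_one, sub_smul, one_smul]
  have h2 : radius n - 1 ≤ 0 := sub_nonpos.2 (radius_lt_one n).le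
  rw [h1, norm_smul, norm_eq_of_mem_sphere, mul_one, Complex.norm_real, Real.norm_of_nonpos h2,
    neg_sub]

/-- Passing from w to rw costs 1 - r, which is itself at most |v - rw|. -/
theorem norm_sub_le_norm_sub_radius_smul (n : ℕ) (w v : Sph d) :
    ‖(v : Cn d) - (w : Cn d)‖ ≤ 2 * ‖(v : Cn d) - (radius n : ℂ) • (w : Cn d)‖ := by
  have h1 := norm_sub_le_norm_sub_add_norm_sub (v : Cn d) ((radius n : ℂ) • (w : Cn d)) (w : Cn d)
  rw [norm_radius_smul_sub] at h1
  linarith [one_sub_radius_le_norm n w v]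

theorem diskKernel_le (n : ℕ) {w v : Sph d} {δ : ℝ} (hδ : 0 < δ) (h : δ ≤ dist w v) :
    diskKernel n w v ≤ (1 - radius n ^ 2) / (δ / 2) ^ 2 := by
  have h0 := one_sub_radius_sq_nonneg n
  rw [dist_comm, Subtype.dist_eq, dist_eq_norm] at h
  have h1 : δ / 2 ≤ ‖(v : Cn d) - (radius n : ℂ) • (w : Cn d)‖ := by
    linarith [norm_sub_le_norm_sub_radius_smul n w v]
  rw [diskKernel, norm_radius]
  exact div_le_div_of_nonneg_left h0 (by positivity) (pow_le_pow_left₀ (by positivity) h1 2)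

/-- Concentration holds on the whole sphere, but the mass over the circle is computed only for v on
that circle; hence the assumption on ν. -/
theorem isApproxKernel_diskKernel {ζ : Proj d} {ν : ComplexMeasure (Sph d)}
    (hν : ν.variation (proj ⁻¹' {ζ})ᶜ = 0) :
    IsApproxKernel (fiberMeasure ζ) ν diskKernel where
  continuous := continuous_diskKernel
  nonneg := diskKernel_nonneg
  integral_eq_one n := by
    have h : ∀ᵐ v ∂ν.variation, v ∈ proj ⁻¹' {ζ} := mem_ae_iff.2 hν
    filter_upwards [h] with v hv
    obtain rfl : proj v = ζ := hv
    exact integral_diskKernel n v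
  concentrated δ hδ ε hε := by
    filter_upwards [(tendsto_one_sub_radius_sq_div ((δ / 2) ^ 2)).eventually_le_const hε]
      with n hn w v hwv
    exact (diskKernel_le n hδ hwv).trans hn

end ApproxKernels

/-! ### Existence and uniqueness of slice measures. -/

section Slices

variable {d : ℕ} {μ : ComplexMeasure (Sph d)} {ζ : Proj d}

/-- The dilate of the Poisson integral of `μ` by `radius n`, as a function on the sphere. -/
noncomputable def dilate (μ : ComplexMeasure (Sph d)) (n : ℕ) (ξ : Sph d) : ℂ :=
  poissonIntegral μ ((radius n : ℂ) • (ξ : Cn d))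

theorem continuous_dilate (hd : 1 ≤ d) (μ : ComplexMeasure (Sph d)) (n : ℕ) :
    Continuous (dilate μ n) :=
  continuous_cIntegral μ
    (Complex.continuous_ofReal.comp ((isApproxKernel_poissonKernel hd μ).continuous n))

/-- The circle is closed, so containing the closed support and carrying all the mass are the same.
-/
theorem isSupportedOnCircle_iff {ν : ComplexMeasure (Sph d)} :
    IsSupportedOnCircle ζ ν ↔ ν.variation (proj ⁻¹' {ζ})ᶜ = 0 := by
  constructor
  · intro h
    have h1 : ν.variation.support ∈ ae ν.variation := Measure.support_mem_ae_of_innerRegular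
    exact mem_ae_iff.1 (mem_of_superset h1 h)
  · exact fun h => Measure.support_subset_of_isClosed (isClosed_fiber ζ) (mem_ae_iff.2 h)

theorem IsSliceMeasure.dilate_eq {ν : ComplexMeasure (Sph d)} (hν : IsSliceMeasure μ ζ ν) (n : ℕ)
    {w : Sph d} (hw : proj w = ζ) :
    dilate μ n w = cIntegral ν fun v => (diskKernel n w v : ℂ) :=
  hν.2 w hw _ ((norm_radius n).trans_lt (radius_lt_one n))

theorem ae_proj_eq_fiberMeasure (ζ : Proj d) : ∀ᵐ w ∂fiberMeasure ζ, proj w = ζ :=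
  mem_ae_iff.2 (fiberMeasure_compl ζ)

theorem IsSliceMeasure.integral_norm_dilate_le {ν : ComplexMeasure (Sph d)}
    (hν : IsSliceMeasure μ ζ ν) (n : ℕ) :
    ∫ w, ‖dilate μ n w‖ ∂fiberMeasure ζ ≤ ν.variation.real Set.univ := by
  refine le_of_eq_of_le (integral_congr_ae ?_)
    ((isApproxKernel_diskKernel (isSupportedOnCircle_iff.1 hν.1)).integral_norm_le n)
  filter_upwards [ae_proj_eq_fiberMeasure ζ] with w hw
  rw [hν.dilate_eq n hw]

theorem IsSliceMeasure.tendsto_integral {ν : ComplexMeasure (Sph d)}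
    (hν : IsSliceMeasure μ ζ ν) (f : C(Sph d, ℂ)) :
    Tendsto (fun n => ∫ w, f w * dilate μ n w ∂fiberMeasure ζ) atTop (𝓝 (cIntegral ν f)) := by
  refine ((isApproxKernel_diskKernel (isSupportedOnCircle_iff.1 hν.1)).tendsto_integral f).congr
    fun n => integral_congr_ae ?_
  filter_upwards [ae_proj_eq_fiberMeasure ζ] with w hw
  rw [hν.dilate_eq n hw]

/-- Both measures are the weak limit of the same dilates, which depend only on μ. -/
theorem IsSliceMeasure.unique {ν ν' : ComplexMeasure (Sph d)} (hν : IsSliceMeasure μ ζ ν)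
    (hν' : IsSliceMeasure μ ζ ν') : ν = ν' :=
  eq_of_cIntegral_eq fun f => tendsto_nhds_unique (hν.tendsto_integral f) (hν'.tendsto_integral f)

theorem IsPluriharmonicMeasure.harmonicOnNhd_slice (hμ : IsPluriharmonicMeasure μ) (ξ : Sph d) :
    InnerProductSpace.HarmonicOnNhd (fun l : ℂ => poissonIntegral μ (l • (ξ : Cn d)))
      (ball 0 1) := by
  have h := hμ.2 0 (ξ : Cn d)
  have h1 : {l : ℂ | 0 + l • (ξ : Cn d) ∈ ball (0 : Cn d) 1} = ball 0 1 := by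
    ext l
    simp [norm_smul]
  rw [h1] at h
  simpa only [zero_add] using h

theorem exists_isSliceMeasure (hd : 1 ≤ d) (hμ : IsPluriharmonicMeasure μ) {c : ℝ}
    (hc : ∃ᶠ n in atTop, ∫ w, ‖dilate μ n w‖ ∂fiberMeasure ζ ≤ c) :
    ∃ ν, IsSliceMeasure μ ζ ν ∧ cNorm ν ≤ ENNReal.ofReal c := by
  obtain ⟨ν, U, hU, hUle, hνc, hνS, hlim⟩ := exists_complexMeasure_tendsto_integral
    (fiberMeasure ζ) (continuous_dilate hd μ) hc (isClosed_fiber ζ) (fiberMeasure_compl ζ)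
  refine ⟨ν, ⟨isSupportedOnCircle_iff.2 hνS, fun ξ hξ z hz => ?_⟩, hνc⟩
  subst hξ
  have hcont : Continuous fun w : Sph d =>
      (((1 - ‖z‖ ^ 2) / ‖(w : Cn d) - z • (ξ : Cn d)‖ ^ 2 : ℝ) : ℂ) :=
    Complex.continuous_ofReal.comp (continuous_const.div (by fun_prop)
      fun w => pow_ne_zero _ (norm_ne_zero_iff.2 (sub_smul_ne_zero hz w ξ)))
  refine tendsto_nhds_unique ?_ (hlim ⟨_, hcont⟩)
  -- The Poisson kernel at z is an admissible test function; against the dilate it reproduces u(r_n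
  -- z ξ), which tends to u(zξ) by continuity.
  have h1 : ∀ n, ∫ w, (⟨_, hcont⟩ : C(Sph d, ℂ)) w * dilate μ n w ∂fiberMeasure (proj ξ) =
      poissonIntegral μ (((radius n : ℂ) * z) • (ξ : Cn d)) := fun n => by
    rw [fiberMeasure_proj, integral_orbitMeasure ξ
      (f := fun w => (⟨_, hcont⟩ : C(Sph d, ℂ)) w * dilate μ n w)
      ((ContinuousMap.continuous _).mul (continuous_dilate hd μ n)),
      ← integral_poisson_disc (hμ.harmonicOnNhd_slice ξ) (radius_pos n) (radius_lt_one n) hz]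
    refine integral_congr_ae (.of_forall fun c => ?_)
    simp only [ContinuousMap.coe_mk, norm_sub_smul_rot, dilate]
    rw [coe_rot, smul_smul]
  simp_rw [h1]
  have hmem : z • (ξ : Cn d) ∈ ball (0 : Cn d) 1 := by simpa [norm_smul] using hz
  have h2 : ContinuousAt (poissonIntegral μ) (z • (ξ : Cn d)) :=
    hμ.1.continuousOn.continuousAt (isOpen_ball.mem_nhds hmem)
  have h3 : Tendsto (fun n => ((radius n : ℂ) * z) • (ξ : Cn d)) atTop (𝓝 (z • (ξ : Cn d))) := by
    have h4 : Tendsto (fun n => (radius n : ℂ)) atTop (𝓝 ((1 : ℝ) : ℂ)) :=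
      (Complex.continuous_ofReal.tendsto 1).comp tendsto_radius
    simpa using (h4.mul_const z).smul_const (ξ : Cn d)
  exact (h2.tendsto.comp h3).mono_left hUle

end Slices

/-! ### Integrability of the slice norms and the weak decomposition. -/

section Decomposition

variable {d : ℕ} {μ : ComplexMeasure (Sph d)} {ζ : Proj d}

instance instCompactSpaceProj : CompactSpace (Proj d) :=
  ⟨by simpa [proj_surjective.range_eq] using isCompact_range (continuous_proj (d := d))⟩

theorem isSliceMeasure_sliceMeasure (h : ∃ ν, IsSliceMeasure μ ζ ν) :
    IsSliceMeasure μ ζ (sliceMeasure μ ζ) := by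
  rw [sliceMeasure, dif_pos h]
  exact h.choose_spec

/-- The `L¹` norm of the dilate of `P[μ]` over the circle over a point of projective space. -/
noncomputable def fiberNorm (μ : ComplexMeasure (Sph d)) (n : ℕ) (ζ : Proj d) : ENNReal :=
  ENNReal.ofReal (∫ w, ‖dilate μ n w‖ ∂fiberMeasure ζ)

theorem continuous_fiberNorm (hd : 1 ≤ d) (μ : ComplexMeasure (Sph d)) (n : ℕ) :
    Continuous (fiberNorm μ n) :=
  ENNReal.continuous_ofReal.comp (continuous_integral_fiberMeasure (continuous_dilate hd μ n).norm)

theorem lintegral_fiberNorm_le (hd : 1 ≤ d) (μ : ComplexMeasure (Sph d)) (n : ℕ) :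
    ∫⁻ ζ, fiberNorm μ n ζ ∂projMeasure d ≤ ENNReal.ofReal (μ.variation.real Set.univ) := by
  have := isProbabilityMeasure_sphereMeasure hd
  have := isProbabilityMeasure_projMeasure hd
  have hc := (continuous_dilate hd μ n).norm
  have h1 : Integrable (fun ζ => ∫ w, ‖dilate μ n w‖ ∂fiberMeasure ζ) (projMeasure d) :=
    integrable_of_continuous _ (continuous_integral_fiberMeasure hc)
  simp_rw [fiberNorm]
  rw [← ofReal_integral_eq_lintegral_ofReal h1
    (.of_forall fun ζ => integral_nonneg fun w => norm_nonneg _),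
    integral_projMeasure_fiberMeasure hd hc]
  exact ENNReal.ofReal_le_ofReal ((isApproxKernel_poissonKernel hd μ).integral_norm_le n)

theorem lintegral_liminf_fiberNorm_lt_top (hd : 1 ≤ d) (μ : ComplexMeasure (Sph d)) :
    ∫⁻ ζ, liminf (fun n => fiberNorm μ n ζ) atTop ∂projMeasure d < ⊤ := by
  refine (lintegral_liminf_le fun n => (continuous_fiberNorm hd μ n).measurable).trans_lt ?_
  refine lt_of_le_of_lt ?_ (ENNReal.ofReal_lt_top (r := μ.variation.real Set.univ))
  exact liminf_le_of_le (by isBoundedDefault) fun b hb =>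
    (hb.exists.choose_spec).trans (lintegral_fiberNorm_le hd μ _)

theorem exists_isSliceMeasure_of_liminf_lt (hd : 1 ≤ d) (hμ : IsPluriharmonicMeasure μ) {c : ℝ}
    (hc : liminf (fun n => fiberNorm μ n ζ) atTop < ENNReal.ofReal c) :
    ∃ ν, IsSliceMeasure μ ζ ν ∧ cNorm ν ≤ ENNReal.ofReal c := by
  have hc0 : 0 ≤ c := by
    by_contra h
    rw [ENNReal.ofReal_of_nonpos (not_le.1 h).le] at hc
    exact not_lt_zero hc
  refine exists_isSliceMeasure hd hμ ((frequently_lt_of_liminf_lt (by isBoundedDefault) hc).mono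
    fun n hn => ?_)
  exact (ENNReal.ofReal_le_ofReal_iff hc0).1 hn.le

theorem ae_isSliceMeasure_sliceMeasure (hd : 1 ≤ d) (hμ : IsPluriharmonicMeasure μ) :
    ∀ᵐ ζ ∂projMeasure d, IsSliceMeasure μ ζ (sliceMeasure μ ζ) := by
  have hm : Measurable fun ζ : Proj d => liminf (fun n => fiberNorm μ n ζ) atTop :=
    Measurable.liminf fun n => (continuous_fiberNorm hd μ n).measurable
  filter_upwards [ae_lt_top hm (lintegral_liminf_fiberNorm_lt_top hd μ).ne] with ζ hζ
  obtain ⟨c, hc⟩ := ENNReal.lt_iff_exists_nnreal_btwn.1 hζ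
  obtain ⟨ν, hν, -⟩ := exists_isSliceMeasure_of_liminf_lt hd hμ (c := c)
    (by rw [ENNReal.ofReal_coe_nnreal]; exact hc.1)
  exact isSliceMeasure_sliceMeasure ⟨ν, hν⟩

theorem IsSliceMeasure.fiberNorm_le {ν : ComplexMeasure (Sph d)} (hν : IsSliceMeasure μ ζ ν)
    (n : ℕ) : fiberNorm μ n ζ ≤ cNorm ν := by
  rw [fiberNorm]
  refine (ENNReal.ofReal_le_ofReal (hν.integral_norm_dilate_le n)).trans_eq ?_
  exact ofReal_measureReal

/-- Existence gives a slice measure of norm at most the lower limit plus ε, which is ν by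
uniqueness; the other inequality holds because the disk kernel does not increase the norm. Slice
measures are picked by choice, so this formula is what makes their norm measurable in ζ. -/
theorem IsSliceMeasure.cNorm_eq_liminf (hd : 1 ≤ d) (hμ : IsPluriharmonicMeasure μ)
    {ν : ComplexMeasure (Sph d)} (hν : IsSliceMeasure μ ζ ν) :
    cNorm ν = liminf (fun n => fiberNorm μ n ζ) atTop := by
  refine le_antisymm (ENNReal.le_of_forall_pos_le_add ?_) ?_
  · intro ε hε hfin
    obtain ⟨ν', hν', hc⟩ := exists_isSliceMeasure_of_liminf_lt hd hμ (ζ := ζ)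
      (c := ((liminf (fun n => fiberNorm μ n ζ) atTop + ε : ENNReal)).toReal) (by
        rw [ENNReal.ofReal_toReal (by finiteness)]
        exact ENNReal.lt_add_right hfin.ne (by exact_mod_cast hε.ne'))
    rw [ENNReal.ofReal_toReal (by finiteness)] at hc
    rwa [hν.unique hν']
  · exact liminf_le_of_le (by isBoundedDefault) fun b hb =>
      (hb.exists.choose_spec).trans (hν.fiberNorm_le _)

theorem isDecomposition_sliceMeasure (hd : 1 ≤ d) (hμ : IsPluriharmonicMeasure μ) :
    IsDecomposition μ (sliceMeasure μ) := by
  have := isProbabilityMeasure_sphereMeasure hd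
  have := isProbabilityMeasure_projMeasure hd
  have hs := ae_isSliceMeasure_sliceMeasure hd hμ
  have hm : Measurable fun ζ : Proj d => liminf (fun n => fiberNorm μ n ζ) atTop :=
    Measurable.liminf fun n => (continuous_fiberNorm hd μ n).measurable
  have hN : (fun ζ => cNorm (sliceMeasure μ ζ)) =ᵐ[projMeasure d]
      fun ζ => liminf (fun n => fiberNorm μ n ζ) atTop := by
    filter_upwards [hs] with ζ hζ using hζ.cNorm_eq_liminf hd hμ
  have hNm : AEMeasurable (fun ζ => cNorm (sliceMeasure μ ζ)) (projMeasure d) := ⟨_, hm, hN⟩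
  have hNt : ∫⁻ ζ, cNorm (sliceMeasure μ ζ) ∂projMeasure d < ⊤ := by
    rw [lintegral_congr_ae hN]
    exact lintegral_liminf_fiberNorm_lt_top hd μ
  have hNi : Integrable (fun ζ => (cNorm (sliceMeasure μ ζ)).toReal) (projMeasure d) :=
    integrable_toReal_of_lintegral_ne_top hNm hNt.ne
  have hfc : ∀ (f : C(Sph d, ℂ)) n, Continuous fun w => f w * dilate μ n w := fun f n =>
    f.continuous.mul (continuous_dilate hd μ n)
  have hF : ∀ (f : C(Sph d, ℂ)) n,
      Continuous fun ζ => ∫ w, f w * dilate μ n w ∂fiberMeasure ζ := fun f n =>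
    continuous_integral_fiberMeasure (hfc f n)
  have hlim : ∀ f : C(Sph d, ℂ), ∀ᵐ ζ ∂projMeasure d,
      Tendsto (fun n => ∫ w, f w * dilate μ n w ∂fiberMeasure ζ) atTop
        (𝓝 (cIntegral (sliceMeasure μ ζ) f)) := fun f => by
    filter_upwards [hs] with ζ hζ using hζ.tendsto_integral f
  have hbound : ∀ (f : C(Sph d, ℂ)) n, ∀ᵐ ζ ∂projMeasure d,
      ‖∫ w, f w * dilate μ n w ∂fiberMeasure ζ‖ ≤ ‖f‖ * (cNorm (sliceMeasure μ ζ)).toReal := by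
    intro f n
    filter_upwards [hs] with ζ hζ
    calc ‖∫ w, f w * dilate μ n w ∂fiberMeasure ζ‖
        ≤ ∫ w, ‖f w * dilate μ n w‖ ∂fiberMeasure ζ := norm_integral_le_integral_norm _
      _ ≤ ∫ w, ‖f‖ * ‖dilate μ n w‖ ∂fiberMeasure ζ := by
          refine integral_mono (integrable_of_continuous _ (hfc f n).norm)
            (integrable_of_continuous _ (continuous_const.mul (continuous_dilate hd μ n).norm))
            fun w => ?_
          simp only [norm_mul]
          exact mul_le_mul_of_nonneg_right (f.norm_coe_le_norm w) (norm_nonneg _)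
      _ = ‖f‖ * ∫ w, ‖dilate μ n w‖ ∂fiberMeasure ζ := integral_const_mul _ _
      _ ≤ _ := mul_le_mul_of_nonneg_left (hζ.integral_norm_dilate_le n) (norm_nonneg _)
  refine ⟨hs.mono fun ζ hζ => hζ.1, hNm, hNt, fun f => ?_, fun f => ?_⟩
  -- Measurability in ζ of the integral against the slice measure comes from its being an almost
  -- everywhere limit of continuous functions.
  · refine (hNi.const_mul ‖f‖).mono' (aestronglyMeasurable_of_tendsto_ae atTop
      (fun n => (hF f n).measurable.aestronglyMeasurable) (hlim f)) ?_
    filter_upwards [ae_all_iff.2 (hbound f), hlim f] with ζ h1 h2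
    exact le_of_tendsto h2.norm (.of_forall h1)
  -- The same sequence ∫ f u_r dσ has both sides of the identity as its limit.
  · refine tendsto_nhds_unique ((isApproxKernel_poissonKernel hd μ).tendsto_integral f) ?_
    refine (tendsto_integral_of_dominated_convergence _
      (fun n => (hF f n).measurable.aestronglyMeasurable) (hNi.const_mul ‖f‖) (hbound f)
      (hlim f)).congr fun n => ?_
    exact integral_projMeasure_fiberMeasure hd (hfc f n)

end Decomposition

end SliceDecomposition

theorem mainTheorem7 (d : ℕ) (hd : 1 ≤ d) (μ : ComplexMeasure (Sph d))
    (hμ : IsPluriharmonicMeasure μ) :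
    (∀ᵐ ζ ∂projMeasure d, IsSliceMeasure μ ζ (sliceMeasure μ ζ) ∧
      ∀ ν : ComplexMeasure (Sph d), IsSliceMeasure μ ζ ν → ν = sliceMeasure μ ζ) ∧
    IsDecomposition μ (sliceMeasure μ) ∧
    IsDecomposable μ := by
  refine ⟨?_, isDecomposition_sliceMeasure hd hμ, _, isDecomposition_sliceMeasure hd hμ⟩
  filter_upwards [ae_isSliceMeasure_sliceMeasure hd hμ] with ζ hζ
  exact ⟨hζ, fun ν hν => hν.unique hζ⟩
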